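/- For $\lambda\in(0,1)$ let $W_\lambda=\{(x,y)\in\mathbb{R}^2 : x^2+y^2/\lambda^2\le 1\}$ and let $D=\max_{u,v\in W_\lambda}\|u-v\|_2$ be its diameter. Let $L\in(0,1)$, $s\in\{1,-1\}$ and $T\ge 2$. Let $P$ be a random variable with distribution $\mathrm{Beta}(k,k)$ for some $k>0$ (or the constant $P=1/2$, the i.i.d. case); conditionally on $P$ let $X_1,\dots,X_T$ be i.i.d. Bernoulli with parameter $P$; put $h_t=(2X_t-1,-sL)$ and consider the linear losses $f_t(\cdot)=\langle h_t,\cdot\rangle$ on $K=W_\lambda$. (For $s=1$ this is the environment of the lower bound of Huang et al.; $s=-1$ is its mirror image.) Let $G\ge\sqrt{1+L^2}$ be a bound on the norms of the gradients $h_t$. The point $x_\star=(0,s\lambda)$ is the unique minimizer over $W_\lambda$ of $x\mapsto\mathbb{E}[\sum_{t=1}^T f_t(x)]$. Let $x_1,\dots,x_T$ be the decisions of the Maler algorithm of Wang et al. (stated below), run on $K=W_\lambda$ with parameters $G$, $D$, $T$. Then $x_t\in W_\lambda$ for all $t$, the random variable $\sum_{t=1}^T (f_t(x_t)-f_t(x_\star))$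 is integrable, and $$\mathsf{R}_T=\mathbb{E}\Big[\sum_{t=1}^T\big(f_t(x_t)-f_t(x_\star)\big)\Big]\le C\Big(\frac{1}{\lambda L}\log T+GD\log T\Big),$$ where, for every $G_0$, the constant $C>0$ can be chosen to depend only on $G_0$ for all $G\le G_0$. It depends neither on $\lambda,L,s,T$ nor on the law of $P$. (It is an absolute constant for $G=\sqrt{1+L^2}\le\sqrt2$.) The Maler algorithm: let $N=\lceil\frac12\log_2T\rceil$, $\eta_i=2^{-i}/(5GD)$ for $0\le i\le N$, $\eta^c=1/(2GD\sqrt T)$, $\beta=\frac12\min\{1/(4G^\ell D),1\}$ with $G^\ell=7/(25D)$, and $\Pi_K^A(y)=\arg\min_{x\in K}(y-x)^\top A(y-x)$. There are a convex expert with decisions $x_t^c$ and weights $\pi_t^c$ and, for each $i$, a strongly convex expert ($x_t^{i,\mathsf s}$, $\pi_t^{i,\mathsf s}$) and an exp-concave expert ($x_t^{i,\ell}$, $\pi_t^{i,\ell}$). All experts start at the origin, with $\pi_1^c=\frac13$ and $\pi_1^{i,\mathsf s}=\pi_1^{i,\ell}=\frac{1+1/(1+N)}{3(i+1)(i+2)}$.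 In round $t$ the algorithm plays $$x_t=\frac{\pi_t^c\eta^cx_t^c+\sum_i(\pi_t^{i,\mathsf s}\eta_ix_t^{i,\mathsf s}+\pi_t^{i,\ell}\eta_ix_t^{i,\ell})}{\pi_t^c\eta^c+\sum_i(\pi_t^{i,\mathsf s}\eta_i+\pi_t^{i,\ell}\eta_i)},$$ observes $g_t=\nabla f_t(x_t)$, multiplies the weights by $e^{-c_t(x_t^c)}$, $e^{-s_t^{i}(x_t^{i,\mathsf s})}$, $e^{-\ell_t^{i}(x_t^{i,\ell})}$ respectively and normalizes them to sum $1$, where $c_t(x)=-\eta^c\langle g_t,x_t-x\rangle+(\eta^cGD)^2$, $s_t^{i}(x)=-\eta_i\langle g_t,x_t-x\rangle+\eta_i^2G^2\|x_t-x\|_2^2$, $\ell_t^{i}(x)=-\eta_i\langle g_t,x_t-x\rangle+\eta_i^2\langle g_t,x_t-x\rangle^2$. The experts update by $x_{t+1}^c=\Pi_K^{I}\big(x_t^c-\frac{D}{\eta^cG\sqrt t}\nabla c_t(x_t^c)\big)$, $x_{t+1}^{i,\mathsf s}=\Pi_K^{I}\big(x_t^{i,\mathsf s}-\frac{1}{2\eta_i^2G^2t}\nabla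 s_t^{i}(x_t^{i,\mathsf s})\big)$, and $x_{t+1}^{i,\ell}=\Pi_K^{\Sigma_{t+1}^i}\big(x_t^{i,\ell}-\frac1\beta(\Sigma_{t+1}^i)^{-1}\nabla\ell_t^{i}(x_t^{i,\ell})\big)$, where $\Sigma_1^i=\frac{1}{\beta^2D^2}I$ and $\Sigma_{t+1}^i=\Sigma_t^i+\nabla\ell_t^{i}(x_t^{i,\ell})\nabla\ell_t^{i}(x_t^{i,\ell})^\top$. -/

import Mathlib

open MeasureTheory ProbabilityTheory Matrix

noncomputable section

namespace OCO

/-- The Euclidean space `ℝ^d`. -/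
abbrev Vec (d : ℕ) : Type := EuclideanSpace ℝ (Fin d)

/-- `M v` for a `d × d` matrix `M` and a vector `v ∈ ℝ^d`. -/
def mulVecE {d : ℕ} (M : Matrix (Fin d) (Fin d) ℝ) (v : Vec d) : Vec d :=
  WithLp.toLp 2 (M *ᵥ WithLp.ofLp v)

/-- The outer product `v vᵀ`. -/
def outer {d : ℕ} (v : Vec d) : Matrix (Fin d) (Fin d) ℝ :=
  Matrix.vecMulVec (WithLp.ofLp v) (WithLp.ofLp v)

open Classical in
/-- The generalized projection `Π_K^A(y) = argmin_{x ∈ K} (y - x)ᵀ A (y - x)`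
(for `A` positive definite and `K` nonempty, closed and convex there is exactly one minimizer). -/
def genProj {d : ℕ} (K : Set (Vec d)) (A : Matrix (Fin d) (Fin d) ℝ) (y : Vec d) : Vec d :=
  if h : ∃ x ∈ K, IsMinOn (fun z : Vec d => inner ℝ (y - z) (mulVecE A (y - z))) K x then
    h.choose
  else y

/-! ### The Maler algorithm

A universal algorithm for online convex optimization over a feasible set `K ⊆ ℝ^d`, with a bound
`G` on the norms of the gradients, the diameter `D` of `K`, and the horizon `T`.  It runs

* one *convex* expert (online gradient descent),
* for each learning rate `η_i` on a grid, one *strongly convex* expert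
  (online gradient descent on the surrogates `s_t^η`), and
* for each `η_i`, one *exp-concave* expert (online Newton step on the surrogates `ℓ_t^η`),

and aggregates them by tilted exponential weights. -/

/-- The largest grid index `⌈(1/2) log₂ T⌉`. -/
def gridSize (T : ℕ) : ℕ := ⌈Real.logb 2 T / 2⌉₊

/-- The learning rates `η_i = 2^{-i} / (5 G D)`, `0 ≤ i ≤ ⌈(1/2) log₂ T⌉`. -/
def gridRate (G D : ℝ) (i : ℕ) : ℝ := 1 / (2 ^ i * (5 * G * D))

/-- The learning rate `η^c = 1 / (2 G D √T)` of the convex expert. -/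
def convexRate (G D : ℝ) (T : ℕ) : ℝ := 1 / (2 * G * D * Real.sqrt T)

/-- The prior weight `A / (3 (i + 1) (i + 2))`, with `A = 1 + 1 / (1 + ⌈(1/2) log₂ T⌉)`, of each of
the two experts with rate `η_i`; the convex expert has prior weight `1 / 3`. -/
def gridPrior (T i : ℕ) : ℝ :=
  (1 + 1 / (1 + (gridSize T : ℝ))) / (3 * ((i : ℝ) + 1) * ((i : ℝ) + 2))

/-- Surrogate loss of the convex expert:
`c_t(x) = -η^c ⟨g_t, x_t - x⟩ + (η^c G D)^2`. -/
def surrC {d : ℕ} (G D η : ℝ) (g xt x : Vec d) : ℝ :=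
  -η * inner ℝ g (xt - x) + (η * G * D) ^ 2

/-- Surrogate loss of a strongly convex expert:
`s_t^η(x) = -η ⟨g_t, x_t - x⟩ + η^2 G^2 ‖x_t - x‖^2`. -/
def surrS {d : ℕ} (G η : ℝ) (g xt x : Vec d) : ℝ :=
  -η * inner ℝ g (xt - x) + η ^ 2 * G ^ 2 * ‖xt - x‖ ^ 2

/-- Surrogate loss of an exp-concave expert:
`ℓ_t^η(x) = -η ⟨g_t, x_t - x⟩ + η^2 ⟨g_t, x_t - x⟩^2`. -/
def surrL {d : ℕ} (η : ℝ) (g xt x : Vec d) : ℝ :=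
  -η * inner ℝ g (xt - x) + η ^ 2 * (inner ℝ g (xt - x)) ^ 2

/-- The gradient of `x ↦ c_t(x)`. -/
def gradC {d : ℕ} (η : ℝ) (g : Vec d) : Vec d := η • g

/-- The gradient of `x ↦ s_t^η(x)`. -/
def gradS {d : ℕ} (G η : ℝ) (g xt x : Vec d) : Vec d :=
  η • g + (2 * η ^ 2 * G ^ 2) • (x - xt)

/-- The gradient of `x ↦ ℓ_t^η(x)`. -/
def gradL {d : ℕ} (η : ℝ) (g xt x : Vec d) : Vec d :=
  η • g + (2 * η ^ 2 * inner ℝ g (x - xt)) • g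

/-- The parameter `β = (1/2) min {1 / (4 G^ℓ D), 1}` of the online Newton step, where
`G^ℓ = 7 / (25 D)` bounds the gradients of the surrogates `ℓ_t^η`. -/
def onsBeta (D : ℝ) : ℝ := 1 / 2 * min (1 / (4 * (7 / (25 * D)) * D)) 1

/-- The state of the algorithm at the beginning of round `t`: the weights and the current
decisions of all experts, and the matrices of the online Newton steps. -/
structure MalerState (d N : ℕ) where
  round : ℕ
  wC : ℝ
  xC : Vec d
  wS : Fin (N + 1) → ℝ
  xS : Fin (N + 1) → Vec d
  wL : Fin (N + 1) → ℝ
  xL : Fin (N + 1) → Vec d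
  sig : Fin (N + 1) → Matrix (Fin d) (Fin d) ℝ

/-- The initial state (round `t = 1`): all experts start at the origin. -/
def malerInit (d : ℕ) (D : ℝ) (T : ℕ) : MalerState d (gridSize T) where
  round := 1
  wC := 1 / 3
  xC := 0
  wS := fun i => gridPrior T i
  xS := fun _ => 0
  wL := fun i => gridPrior T i
  xL := fun _ => 0
  sig := fun _ => (1 / (onsBeta D ^ 2 * D ^ 2)) • (1 : Matrix (Fin d) (Fin d) ℝ)

/-- The decision played by the meta-algorithm: the average of the experts' decisions, weighted by
the products of the experts' weights and learning rates. -/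
def malerPlay {d : ℕ} (G D : ℝ) (T : ℕ) (S : MalerState d (gridSize T)) : Vec d :=
  (S.wC * convexRate G D T
      + ∑ i, (S.wS i * gridRate G D i + S.wL i * gridRate G D i))⁻¹ •
    ((S.wC * convexRate G D T) • S.xC
      + ∑ i, ((S.wS i * gridRate G D i) • S.xS i + (S.wL i * gridRate G D i) • S.xL i))

/-- The update after the gradient `g` was observed at the decision played. -/
def malerUpdate {d : ℕ} (K : Set (Vec d)) (G D : ℝ) (T : ℕ)
    (S : MalerState d (gridSize T)) (g : Vec d) : MalerState d (gridSize T) :=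
  let xt : Vec d := malerPlay G D T S
  let ηc : ℝ := convexRate G D T
  let η : Fin (gridSize T + 1) → ℝ := fun i => gridRate G D i
  let vC : ℝ := S.wC * Real.exp (-surrC G D ηc g xt S.xC)
  let vS : Fin (gridSize T + 1) → ℝ :=
    fun i => S.wS i * Real.exp (-surrS G (η i) g xt (S.xS i))
  let vL : Fin (gridSize T + 1) → ℝ :=
    fun i => S.wL i * Real.exp (-surrL (η i) g xt (S.xL i))
  let Φ : ℝ := vC + ∑ i, (vS i + vL i)
  let grL : Fin (gridSize T + 1) → Vec d := fun i => gradL (η i) g xt (S.xL i)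
  let sig' : Fin (gridSize T + 1) → Matrix (Fin d) (Fin d) ℝ :=
    fun i => S.sig i + outer (grL i)
  { round := S.round + 1
    wC := vC / Φ
    xC := genProj K 1 (S.xC - (D / (ηc * G * Real.sqrt S.round)) • gradC ηc g)
    wS := fun i => vS i / Φ
    xS := fun i => genProj K 1
      (S.xS i - (1 / (2 * η i ^ 2 * G ^ 2 * S.round)) • gradS G (η i) g xt (S.xS i))
    wL := fun i => vL i / Φ
    xL := fun i => genProj K (sig' i)
      (S.xL i - (1 / onsBeta D) • mulVecE (sig' i)⁻¹ (grL i))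
    sig := sig' }

/-- The state of the algorithm after `n` rounds against the losses `f 0, f 1, …`; in each round
only the gradient of the current loss at the decision played is revealed. -/
def malerState {d : ℕ} (K : Set (Vec d)) (G D : ℝ) (T : ℕ) (f : ℕ → Vec d → ℝ) :
    ℕ → MalerState d (gridSize T)
  | 0 => malerInit d D T
  | n + 1 =>
    malerUpdate K G D T (malerState K G D T f n)
      (gradient (f n) (malerPlay G D T (malerState K G D T f n)))

/-- The decision of the algorithm against the losses `f 0, f 1, …` in the round with loss `f n`. -/
def maler {d : ℕ} (K : Set (Vec d)) (G D : ℝ) (T : ℕ) (f : ℕ → Vec d → ℝ) (n : ℕ) : Vec d :=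
  malerPlay G D T (malerState K G D T f n)

/-! ### The feasible set and the environment -/

/-- The ellipse `W_λ = {(x, y) : x^2 + y^2 / λ^2 ≤ 1}`. -/
def ellipse (lam : ℝ) : Set (Vec 2) := {v | v 0 ^ 2 + v 1 ^ 2 / lam ^ 2 ≤ 1}

/-- Conditionally on the random parameter `P`, the variables `X 0, …, X (T - 1)` are i.i.d.
Bernoulli with success probability `P`:
`ℙ(P ∈ B, X 0 = x 0, …, X (T - 1) = x (T - 1)) = ∫_B ∏_i p^{x i} (1 - p)^{1 - x i} d(law of P)(p)`
for every Borel set `B` and every `x ∈ {0, 1}^T`. -/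
structure IsBernoulliMixture {Ω : Type*} [MeasurableSpace Ω] (μ : Measure Ω)
    (P : Ω → ℝ) (X : ℕ → Ω → Bool) (T : ℕ) : Prop where
  measurable_P : Measurable P
  measurable_X : ∀ t < T, Measurable (X t)
  joint_law : ∀ (B : Set ℝ), MeasurableSet B → ∀ x : Fin T → Bool,
    μ {ω | P ω ∈ B ∧ ∀ i : Fin T, X i ω = x i} =
      ∫⁻ p in B, ∏ i : Fin T, ENNReal.ofReal (if x i then p else 1 - p) ∂(μ.map P)

/-- The loss vector `(2 X - 1, -s L)` for a Bernoulli outcome `X ∈ {0, 1}` and a sign `s`. -/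
def lossVec (s L : ℝ) (b : Bool) : Vec 2 := !₂[2 * (if b then 1 else 0) - 1, -(s * L)]

/-- The linear losses `f_t = ⟨h_t, ·⟩`, `h_t = (2 X_t - 1, -s L)`, at the outcome `ω`. -/
def envLoss {Ω : Type*} (s L : ℝ) (X : ℕ → Ω → Bool) (ω : Ω) (t : ℕ) (x : Vec 2) : ℝ :=
  inner ℝ (lossVec s L (X t ω)) x

/-- The point `(0, s λ)`. -/
def xStar (s lam : ℝ) : Vec 2 := !₂[0, s * lam]

/-- The decision in round `t`, at the outcome `ω`, of the Maler algorithm on `K = W_λ` with gradient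
bound `G`, the diameter of `W_λ` and horizon `T`, run against the losses `envLoss s L X ω`. -/
def envPlay {Ω : Type*} (lam s L G : ℝ) (T : ℕ) (X : ℕ → Ω → Bool) (ω : Ω) (t : ℕ) : Vec 2 :=
  maler (ellipse lam) G (Metric.diam (ellipse lam)) T (envLoss s L X ω) t

/-- The realized regret `∑_t (f_t(x_t) - f_t(z))` over `T` rounds against the comparator `z`. -/
def pathRegret {d : ℕ} (T : ℕ) (f : ℕ → Vec d → ℝ) (x : ℕ → Vec d) (z : Vec d) : ℝ :=
  ∑ t ∈ Finset.range T, (f t (x t) - f t z)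

end OCO

end

namespace OCO

/-! ### The regret of the Maler algorithm against its strongly convex surrogates -/

/-! Condition on P = p. The loss vectors are then i.i.d. with mean v = (2p - 1, -sL), and x_t
depends only on earlier outcomes, so the expected regret R against a fixed u is the expectation of
the sum of ⟨v, x_t - u⟩. Let u be the minimizer of ⟨v, ·⟩ on the ellipse. Curvature gives ⟨v, x - u⟩
≥ (λL/2)‖x - u‖² (`exists_minimizer_ellipse`), hence V ≤ 2R/(λL) for the expected sum V of ‖x_t -
u‖².

On every path, each grid rate η satisfies η · regret ≤ η²G² ∑‖x_t - u‖² + O(log T)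
(`gridRate_mul_regret_le`). This uses only the strongly convex expert of rate η: the meta-weights
compete with it, and it competes with u. In expectation ηR ≤ η²G²V + O(log T). A rate near λL/(4G²)
lets half of ηR absorb the quadratic term, and the extreme rates cover the case where the grid has
none (`le_of_forall_gridRate`).

Since u minimizes the conditional mean loss, regret against x⋆ is at most R
(`expected_pathRegret_le`). The bound is uniform in p, so it survives integration over the law of P.
That law enters only through its support in [0, 1] and, for the optimality of x⋆, its mean 1/2. -/

lemma exp_sub_sq_le_one_add {a : ℝ} (ha : |a| ≤ 1 / 2) : Real.exp (a - a ^ 2) ≤ 1 + a := by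
  obtain ⟨h1, h2⟩ := abs_le.1 ha
  have hpos : 0 < 1 + a := by linarith
  rw [← Real.le_log_iff_exp_le hpos, ← neg_le_neg_iff, ← Real.log_inv,
    Real.log_le_iff_le_exp (inv_pos.2 hpos), inv_le_iff_one_le_mul₀ hpos]
  -- The goal is now 1 ≤ exp(a² - a)(1 + a). For a ≥ 0 the first-order bound suffices, as (1 - a +
  -- a²)(1 + a) = 1 + a³; for a ≤ 0 the second-order term is needed.
  rcases le_total 0 a with h | h
  · nlinarith [Real.add_one_le_exp (-(a - a ^ 2)), pow_nonneg h 3]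
  · have hb : 0 ≤ -(a - a ^ 2) := by nlinarith
    have hq := Real.quadratic_le_exp_of_nonneg hb
    have key : 1 ≤ (1 + -(a - a ^ 2) + (-(a - a ^ 2)) ^ 2 / 2) * (1 + a) := by
      have h3 : 0 ≤ a ^ 2 * (1 + a - a ^ 2 + a ^ 3) := by
        apply mul_nonneg (sq_nonneg a)
        nlinarith [mul_nonneg (neg_nonneg.2 h) (by linarith : 0 ≤ 1 / 2 + a), sq_nonneg a]
      nlinarith
    nlinarith

variable {d : ℕ}

/-! ### Projections and convex combinations -/

lemma continuous_quadratic (A : Matrix (Fin d) (Fin d) ℝ) (y : Vec d) :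
    Continuous fun z : Vec d => inner ℝ (y - z) (mulVecE A (y - z)) := by
  have h : Continuous fun v : Vec d => mulVecE A v := by
    unfold mulVecE
    exact (PiLp.continuous_toLp 2 _).comp
      (Continuous.matrix_mulVec continuous_const (PiLp.continuous_ofLp 2 _))
  have hs : Continuous fun z : Vec d => y - z := continuous_const.sub continuous_id
  exact hs.inner (h.comp hs)

lemma genProj_spec {K : Set (Vec d)} (hK : IsCompact K) (hne : K.Nonempty)
    (A : Matrix (Fin d) (Fin d) ℝ) (y : Vec d) :
    genProj K A y ∈ K ∧
      IsMinOn (fun z : Vec d => inner ℝ (y - z) (mulVecE A (y - z))) K (genProj K A y) := by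
  have h := hK.exists_isMinOn hne (continuous_quadratic A y).continuousOn
  rw [genProj, dif_pos h]
  exact h.choose_spec

/-- For the identity matrix this is the metric projection, and the obtuse-angle criterion ⟨y - x, u
- x⟩ ≤ 0 gives the claim. -/
lemma genProj_one_norm_sub_le {K : Set (Vec d)} (hK : IsCompact K) (hKc : Convex ℝ K) (y : Vec d)
    {u : Vec d} (hu : u ∈ K) : ‖genProj K 1 y - u‖ ≤ ‖y - u‖ := by
  obtain ⟨hx, hmin⟩ := genProj_spec hK ⟨u, hu⟩ 1 y
  set x := genProj K 1 y
  have hle : ∀ z ∈ K, ‖y - x‖ ≤ ‖y - z‖ := by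
    intro z hz
    have h := hmin hz
    simp only [Set.mem_ofPred_eq, mulVecE, Matrix.one_mulVec, WithLp.toLp_ofLp,
      real_inner_self_eq_norm_sq] at h
    exact le_of_sq_le_sq h (norm_nonneg _)
  have hinf : ‖y - x‖ = ⨅ w : K, ‖y - w‖ := by
    have : Nonempty K := ⟨⟨u, hu⟩⟩
    refine le_antisymm (le_ciInf fun w => hle w w.2) ?_
    exact ciInf_le (f := fun w : K => ‖y - w‖) ⟨0, by rintro _ ⟨w, rfl⟩; exact norm_nonneg _⟩
      ⟨x, hx⟩
  have h := (norm_eq_iInf_iff_real_inner_le_zero hKc hx).1 hinf u hu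
  have hsq : ‖y - u‖ ^ 2 = ‖y - x‖ ^ 2 + 2 * inner ℝ (y - x) (x - u) + ‖x - u‖ ^ 2 := by
    rw [← norm_add_sq_real]; congr 2; abel
  have h' : 0 ≤ inner ℝ (y - x) (x - u) := by
    rw [← neg_sub u x, inner_neg_right]; linarith
  exact le_of_sq_le_sq (by nlinarith [sq_nonneg ‖y - x‖]) (norm_nonneg _)

lemma exists_smul_eq_weighted_sum {K : Set (Vec d)} (hKc : Convex ℝ K) {ι : Type*} (S : Finset ι)
    {c : ℝ} (hc : 0 < c) {x : Vec d} (hx : x ∈ K) {a b : ι → ℝ} (ha : ∀ i, 0 < a i)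
    (hb : ∀ i, 0 < b i) {y z : ι → Vec d} (hy : ∀ i, y i ∈ K) (hz : ∀ i, z i ∈ K) :
    ∃ w ∈ K, c • x + ∑ i ∈ S, (a i • y i + b i • z i) = (c + ∑ i ∈ S, (a i + b i)) • w := by
  have pair : ∀ {p q : ℝ} {v w : Vec d}, 0 < p → 0 < q → v ∈ K → w ∈ K →
      ∃ r ∈ K, p • v + q • w = (p + q) • r := by
    intro p q v w hp hq hv hw
    refine ⟨(p / (p + q)) • v + (q / (p + q)) • w,
      hKc hv hw (by positivity) (by positivity) (by field_simp), ?_⟩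
    rw [smul_add, smul_smul, smul_smul, mul_div_cancel₀ _ (by positivity),
      mul_div_cancel₀ _ (by positivity)]
  classical
  induction S using Finset.induction_on with
  | empty => exact ⟨x, hx, by simp⟩
  | insert i S hi ih =>
    obtain ⟨w, hw, e⟩ := ih
    obtain ⟨w₁, hw₁, e₁⟩ := pair (ha i) (hb i) (hy i) (hz i)
    have hpos : 0 < c + ∑ i ∈ S, (a i + b i) :=
      add_pos_of_pos_of_nonneg hc (Finset.sum_nonneg fun i _ => (add_pos (ha i) (hb i)).le)
    obtain ⟨w₂, hw₂, e₂⟩ := pair hpos (add_pos (ha i) (hb i)) hw hw₁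
    refine ⟨w₂, hw₂, ?_⟩
    rw [Finset.sum_insert hi, Finset.sum_insert hi, e₁, add_left_comm, e, add_comm, e₂]
    congr 1; ring

/-- The weights of the state are positive and sum to one, and all experts' decisions are feasible. -/
structure MalerState.Feasible {N : ℕ} (K : Set (Vec d)) (S : MalerState d N) : Prop where
  wC_pos : 0 < S.wC
  wS_pos : ∀ i, 0 < S.wS i
  wL_pos : ∀ i, 0 < S.wL i
  sum_eq : S.wC + ∑ i, (S.wS i + S.wL i) = 1
  xC_mem : S.xC ∈ K
  xS_mem : ∀ i, S.xS i ∈ K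
  xL_mem : ∀ i, S.xL i ∈ K

/-! ### Rates, prior weights and feasibility of the state -/

lemma gridRate_pos {G D : ℝ} (hG : 0 < G) (hD : 0 < D) (i : ℕ) : 0 < gridRate G D i := by
  unfold gridRate; positivity

lemma convexRate_pos {G D : ℝ} (hG : 0 < G) (hD : 0 < D) {T : ℕ} (hT : 1 ≤ T) :
    0 < convexRate G D T := by
  have : (0 : ℝ) < T := by exact_mod_cast hT
  unfold convexRate; positivity

lemma gridPrior_pos (T i : ℕ) : 0 < gridPrior T i := by unfold gridPrior; positivity

lemma gridRate_mul_le {G D : ℝ} (hG : 0 < G) (hD : 0 < D) (i : ℕ) :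
    gridRate G D i * (G * D) ≤ 1 / 5 := by
  have h : (1 : ℝ) ≤ 2 ^ i := one_le_pow₀ (by norm_num)
  have : gridRate G D i * (G * D) = 1 / (5 * 2 ^ i) := by unfold gridRate; field_simp
  rw [this]
  exact one_div_le_one_div_of_le (by norm_num) (by linarith)

lemma convexRate_mul_le {G D : ℝ} (hG : 0 < G) (hD : 0 < D) {T : ℕ} (hT : 1 ≤ T) :
    convexRate G D T * (G * D) ≤ 1 / 2 := by
  have h : 1 ≤ Real.sqrt T := Real.one_le_sqrt.2 (by exact_mod_cast hT)
  have : convexRate G D T * (G * D) = 1 / (2 * Real.sqrt T) := by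
    unfold convexRate; field_simp
  rw [this]
  exact one_div_le_one_div_of_le (by norm_num) (by linarith)

/-- The sum of 1/((i+1)(i+2)) telescopes to (N+1)/(N+2), which the factor 1 + 1/(1+N) inverts. -/
lemma sum_gridPrior (T : ℕ) :
    (1 / 3 : ℝ) + ∑ i : Fin (gridSize T + 1), (gridPrior T i + gridPrior T i) = 1 := by
  have h : ∀ n : ℕ, ∑ i ∈ Finset.range n, 1 / (((i : ℝ) + 1) * (i + 2)) = n / (n + 1) := by
    intro n
    induction n with
    | zero => simp
    | succ n ih => rw [Finset.sum_range_succ, ih]; push_cast; field_simp; ring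
  have e : ∀ i : ℕ, gridPrior T i + gridPrior T i =
      2 / 3 * (1 + 1 / (1 + (gridSize T : ℝ))) * (1 / (((i : ℝ) + 1) * (i + 2))) := by
    intro i; unfold gridPrior; field_simp; ring
  rw [Fin.sum_univ_eq_sum_range (fun i => gridPrior T i + gridPrior T i)]
  simp only [e]
  rw [← Finset.mul_sum, h]
  push_cast
  field_simp
  ring

lemma feasible_malerInit {K : Set (Vec d)} (h0 : (0 : Vec d) ∈ K) (D : ℝ) (T : ℕ) :
    (malerInit d D T).Feasible K where
  wC_pos := by norm_num [malerInit]
  wS_pos i := gridPrior_pos T i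
  wL_pos i := gridPrior_pos T i
  sum_eq := sum_gridPrior T
  xC_mem := h0
  xS_mem _ := h0
  xL_mem _ := h0

/-- Weighting by the rates makes the tilted deviations from the experts cancel; this is what removes
the linear terms from the potential in `sum_weights_exp_neg_surr_le_one`. -/
lemma malerPlay_spec {K : Set (Vec d)} (hKc : Convex ℝ K) {G D : ℝ} (hG : 0 < G) (hD : 0 < D)
    {T : ℕ} (hT : 1 ≤ T) {S : MalerState d (gridSize T)} (hS : S.Feasible K) :
    malerPlay G D T S ∈ K ∧
      (S.wC * convexRate G D T) • (malerPlay G D T S - S.xC)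
        + ∑ i, ((S.wS i * gridRate G D i) • (malerPlay G D T S - S.xS i)
          + (S.wL i * gridRate G D i) • (malerPlay G D T S - S.xL i)) = 0 := by
  have ha := fun i : Fin (gridSize T + 1) => mul_pos (hS.wS_pos i) (gridRate_pos hG hD i)
  have hb := fun i : Fin (gridSize T + 1) => mul_pos (hS.wL_pos i) (gridRate_pos hG hD i)
  have hc := mul_pos hS.wC_pos (convexRate_pos hG hD hT)
  obtain ⟨w, hw, e⟩ := exists_smul_eq_weighted_sum hKc Finset.univ hc hS.xC_mem ha hb
    hS.xS_mem hS.xL_mem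
  have hpos := add_pos_of_pos_of_nonneg hc
    (Finset.sum_nonneg fun i (_ : i ∈ Finset.univ) => (add_pos (ha i) (hb i)).le)
  have hplay : malerPlay G D T S = w := by
    rw [malerPlay, e, smul_smul, inv_mul_cancel₀ hpos.ne', one_smul]
  refine ⟨hplay ▸ hw, ?_⟩
  rw [hplay]
  have : ∀ i : Fin (gridSize T + 1), (S.wS i * gridRate G D i) • (w - S.xS i)
      + (S.wL i * gridRate G D i) • (w - S.xL i)
      = (S.wS i * gridRate G D i + S.wL i * gridRate G D i) • w
        - ((S.wS i * gridRate G D i) • S.xS i + (S.wL i * gridRate G D i) • S.xL i) := by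
    intro i; rw [smul_sub, smul_sub, add_smul]; abel
  simp only [this, Finset.sum_sub_distrib, ← Finset.sum_smul]
  rw [smul_sub, sub_add_sub_comm, ← add_smul, e, sub_self]

/-- One round does not increase the total weight before normalization. -/
lemma sum_weights_exp_neg_surr_le_one {K : Set (Vec d)} (hKc : Convex ℝ K) {G D : ℝ} (hG : 0 < G)
    (hD : 0 < D) (hdiam : ∀ x ∈ K, ∀ y ∈ K, ‖x - y‖ ≤ D) {T : ℕ} (hT : 1 ≤ T)
    {S : MalerState d (gridSize T)} (hS : S.Feasible K) {g : Vec d} (hg : ‖g‖ ≤ G) :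
    S.wC * Real.exp (-surrC G D (convexRate G D T) g (malerPlay G D T S) S.xC)
      + ∑ i, (S.wS i * Real.exp (-surrS G (gridRate G D i) g (malerPlay G D T S) (S.xS i))
        + S.wL i * Real.exp (-surrL (gridRate G D i) g (malerPlay G D T S) (S.xL i))) ≤ 1 := by
  obtain ⟨hx, hzero⟩ := malerPlay_spec hKc hG hD hT hS
  set x := malerPlay G D T S
  have hinner : ∀ y ∈ K, |inner ℝ g (x - y)| ≤ G * ‖x - y‖ := fun y _ =>
    (abs_real_inner_le_norm _ _).trans (mul_le_mul_of_nonneg_right hg (norm_nonneg _))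
  have habs : ∀ {η : ℝ} {y : Vec d}, 0 < η → y ∈ K →
      |η * inner ℝ g (x - y)| ≤ η * (G * D) := by
    intro η y hη hy
    rw [abs_mul, abs_of_pos hη]
    exact mul_le_mul_of_nonneg_left ((hinner y hy).trans
      (mul_le_mul_of_nonneg_left (hdiam x hx y hy) hG.le)) hη.le
  -- Every surrogate is -a + b with a = η⟨g, x - y⟩ and b ≥ a², so its exponential weight is at most
  -- exp(a - a²) ≤ 1 + a.
  have hsurr : ∀ {η b : ℝ} {y : Vec d}, 0 < η → η * (G * D) ≤ 1 / 2 → y ∈ K →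
      (η * inner ℝ g (x - y)) ^ 2 ≤ b →
      Real.exp (-(-η * inner ℝ g (x - y) + b)) ≤ 1 + η * inner ℝ g (x - y) := by
    intro η b y hη hη' hy hb
    refine le_trans (Real.exp_le_exp.2 ?_) (exp_sub_sq_le_one_add ((habs hη hy).trans hη'))
    linarith
  have hηc := convexRate_pos hG hD hT
  have hC : Real.exp (-surrC G D (convexRate G D T) g x S.xC) ≤
      1 + convexRate G D T * inner ℝ g (x - S.xC) := by
    refine hsurr hηc (convexRate_mul_le hG hD hT) hS.xC_mem ?_
    rw [mul_assoc]
    exact sq_le_sq' (abs_le.1 (habs hηc hS.xC_mem)).1 (abs_le.1 (habs hηc hS.xC_mem)).2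
  have hη' : ∀ i, gridRate G D i * (G * D) ≤ 1 / 2 := fun i =>
    (gridRate_mul_le hG hD i).trans (by norm_num)
  have hSb : ∀ i : Fin (gridSize T + 1), Real.exp (-surrS G (gridRate G D i) g x (S.xS i)) ≤
      1 + gridRate G D i * inner ℝ g (x - S.xS i) := by
    intro i
    refine hsurr (gridRate_pos hG hD i) (hη' i) (hS.xS_mem i) ?_
    rw [mul_pow, mul_assoc, ← mul_pow G]
    exact mul_le_mul_of_nonneg_left
      (sq_le_sq' (abs_le.1 (hinner _ (hS.xS_mem i))).1 (abs_le.1 (hinner _ (hS.xS_mem i))).2)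
      (sq_nonneg _)
  have hLb : ∀ i : Fin (gridSize T + 1), Real.exp (-surrL (gridRate G D i) g x (S.xL i)) ≤
      1 + gridRate G D i * inner ℝ g (x - S.xL i) := by
    intro i
    refine hsurr (gridRate_pos hG hD i) (hη' i) (hS.xL_mem i) ?_
    rw [mul_pow]
  have hlin := congrArg (fun v => (inner ℝ g v : ℝ)) hzero
  simp only [inner_add_right, inner_sum, inner_smul_right, inner_zero_right] at hlin
  calc _ ≤ S.wC * (1 + convexRate G D T * inner ℝ g (x - S.xC))
        + ∑ i : Fin (gridSize T + 1), (S.wS i * (1 + gridRate G D i * inner ℝ g (x - S.xS i))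
          + S.wL i * (1 + gridRate G D i * inner ℝ g (x - S.xL i))) :=
        add_le_add (mul_le_mul_of_nonneg_left hC hS.wC_pos.le)
          (Finset.sum_le_sum fun i _ => add_le_add
            (mul_le_mul_of_nonneg_left (hSb i) (hS.wS_pos i).le)
            (mul_le_mul_of_nonneg_left (hLb i) (hS.wL_pos i).le))
    _ = (S.wC + ∑ i, (S.wS i + S.wL i)) + (S.wC * convexRate G D T * inner ℝ g (x - S.xC)
          + ∑ i : Fin (gridSize T + 1), (S.wS i * gridRate G D i * inner ℝ g (x - S.xS i)
            + S.wL i * gridRate G D i * inner ℝ g (x - S.xL i))) := by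
        rw [add_add_add_comm, ← Finset.sum_add_distrib]
        congr 1
        · ring
        · exact Finset.sum_congr rfl fun i _ => by ring
    _ = 1 := by rw [hlin, hS.sum_eq, add_zero]
    _ ≤ 1 := le_rfl

lemma sum_weights_exp_pos {K : Set (Vec d)} {N : ℕ} {S : MalerState d N} (hS : S.Feasible K)
    (a : ℝ) (b c : Fin (N + 1) → ℝ) :
    0 < S.wC * Real.exp a + ∑ i, (S.wS i * Real.exp (b i) + S.wL i * Real.exp (c i)) :=
  add_pos_of_pos_of_nonneg (mul_pos hS.wC_pos (Real.exp_pos _)) (Finset.sum_nonneg fun i _ =>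
    (add_pos (mul_pos (hS.wS_pos i) (Real.exp_pos _)) (mul_pos (hS.wL_pos i) (Real.exp_pos _))).le)

lemma MalerState.Feasible.update {K : Set (Vec d)} (hK : IsCompact K) {T : ℕ}
    {S : MalerState d (gridSize T)} (hS : S.Feasible K) (G D : ℝ) (g : Vec d) :
    (malerUpdate K G D T S g).Feasible K := by
  have hne : K.Nonempty := ⟨_, hS.xC_mem⟩
  have hpos := sum_weights_exp_pos hS
    (-surrC G D (convexRate G D T) g (malerPlay G D T S) S.xC)
    (fun i => -surrS G (gridRate G D i) g (malerPlay G D T S) (S.xS i))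
    (fun i => -surrL (gridRate G D i) g (malerPlay G D T S) (S.xL i))
  refine ⟨div_pos (mul_pos hS.wC_pos (Real.exp_pos _)) hpos,
    fun i => div_pos (mul_pos (hS.wS_pos i) (Real.exp_pos _)) hpos,
    fun i => div_pos (mul_pos (hS.wL_pos i) (Real.exp_pos _)) hpos, ?_,
    (genProj_spec hK hne _ _).1, fun _ => (genProj_spec hK hne _ _).1,
    fun _ => (genProj_spec hK hne _ _).1⟩
  simp only [malerUpdate, ← add_div, ← Finset.sum_div]
  exact div_self hpos.ne'

lemma feasible_malerState {K : Set (Vec d)} (hK : IsCompact K) (h0 : (0 : Vec d) ∈ K) (G D : ℝ)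
    (T : ℕ) (f : ℕ → Vec d → ℝ) (n : ℕ) : (malerState K G D T f n).Feasible K := by
  induction n with
  | zero => exact feasible_malerInit h0 D T
  | succ n ih => exact ih.update hK G D _

lemma maler_mem {K : Set (Vec d)} (hK : IsCompact K) (hKc : Convex ℝ K) (h0 : (0 : Vec d) ∈ K)
    {G D : ℝ} (hG : 0 < G) (hD : 0 < D) {T : ℕ} (hT : 1 ≤ T) (f : ℕ → Vec d → ℝ) (n : ℕ) :
    maler K G D T f n ∈ K :=
  (malerPlay_spec hKc hG hD hT (feasible_malerState hK h0 G D T f n)).1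

/-- The algorithm is non-anticipating; independence of the decision from the current outcome rests
on this. -/
lemma malerState_congr (K : Set (Vec d)) (G D : ℝ) (T : ℕ) {f f' : ℕ → Vec d → ℝ} {n : ℕ}
    (h : ∀ k < n, f k = f' k) : malerState K G D T f n = malerState K G D T f' n := by
  induction n with
  | zero => rfl
  | succ n ih =>
    rw [malerState, malerState, ih fun k hk => h k (by omega), h n (by omega)]

lemma malerState_round (K : Set (Vec d)) (G D : ℝ) (T : ℕ) (f : ℕ → Vec d → ℝ) (n : ℕ) :
    (malerState K G D T f n).round = n + 1 := by
  induction n with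
  | zero => rfl
  | succ n ih =>
    change (malerState K G D T f n).round + 1 = _
    rw [ih]

/-- A projected gradient step with step size `1 / (2 a t)` on a surrogate that is
`2a`-strongly convex. -/
lemma surrS_sub_le {K : Set (Vec d)} (hK : IsCompact K) (hKc : Convex ℝ K) {G D : ℝ} (hG : 0 < G)
    (hdiam : ∀ x ∈ K, ∀ y ∈ K, ‖x - y‖ ≤ D) {η : ℝ} (hη : 0 < η)
    (hηD : η * (G * D) ≤ 1 / 5) {g : Vec d} (hg : ‖g‖ ≤ G) {xt x u : Vec d} (hxt : xt ∈ K)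
    (hx : x ∈ K) (hu : u ∈ K) {t : ℝ} (ht : 0 < t) :
    surrS G η g xt x - surrS G η g xt u ≤ η ^ 2 * G ^ 2 * (t - 1) * ‖x - u‖ ^ 2
      - η ^ 2 * G ^ 2 * t *
        ‖genProj K 1 (x - (1 / (2 * η ^ 2 * G ^ 2 * t)) • gradS G η g xt x) - u‖ ^ 2
      + 1 / 2 * t⁻¹ := by
  set v := gradS G η g xt x with hv
  set γ := 1 / (2 * η ^ 2 * G ^ 2 * t) with hγ
  -- The surrogate is quadratic with Hessian 2η²G² times the identity, so its second-order expansion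
  -- is exact.
  have hlin : surrS G η g xt x - surrS G η g xt u
      = inner ℝ v (x - u) - η ^ 2 * G ^ 2 * ‖x - u‖ ^ 2 := by
    have e1 : ‖xt - u‖ ^ 2 = ‖xt - x‖ ^ 2 + 2 * inner ℝ (xt - x) (x - u) + ‖x - u‖ ^ 2 := by
      rw [← norm_add_sq_real]; congr 2; abel
    have e2 : inner ℝ g (xt - u) = (inner ℝ g (xt - x) + inner ℝ g (x - u) : ℝ) := by
      rw [← inner_add_right]; congr 1; abel
    have e3 : (inner ℝ (x - xt) (x - u) : ℝ) = - inner ℝ (xt - x) (x - u) := by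
      rw [← inner_neg_left]; congr 1; abel
    rw [hv]
    simp only [surrS, gradS, inner_add_left, real_inner_smul_left, e1, e2, e3]
    ring
  -- The gradient has norm at most ηG(1 + 2ηGD) ≤ (7/5)ηG, and (7/5)² < 2.
  have hvn : ‖v‖ ^ 2 ≤ 2 * (η ^ 2 * G ^ 2) := by
    have h1 : ‖v‖ ≤ 7 / 5 * (η * G) := by
      calc ‖v‖ ≤ ‖η • g‖ + ‖(2 * η ^ 2 * G ^ 2) • (x - xt)‖ := norm_add_le _ _
        _ = η * ‖g‖ + 2 * η ^ 2 * G ^ 2 * ‖x - xt‖ := by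
          rw [norm_smul, norm_smul, Real.norm_of_nonneg hη.le,
            Real.norm_of_nonneg (by positivity)]
        _ ≤ η * G + 2 * η ^ 2 * G ^ 2 * D := by
          gcongr
          exact hdiam x hx xt hxt
        _ = η * G * (1 + 2 * (η * (G * D))) := by ring
        _ ≤ η * G * (7 / 5) := by
          apply mul_le_mul_of_nonneg_left _ (by positivity); linarith
        _ = _ := by ring
    have h2 := pow_le_pow_left₀ (norm_nonneg v) h1 2
    nlinarith [sq_nonneg (η * G)]
  have hproj := pow_le_pow_left₀ (norm_nonneg _)
    (genProj_one_norm_sub_le hK hKc (x - γ • v) hu) 2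
  have hexp : ‖x - γ • v - u‖ ^ 2 = ‖x - u‖ ^ 2 - 2 * (γ * inner ℝ v (x - u))
      + γ ^ 2 * ‖v‖ ^ 2 := by
    have : x - γ • v - u = (x - u) - γ • v := by abel
    rw [this, norm_sub_sq_real, real_inner_smul_right, norm_smul, mul_pow, Real.norm_eq_abs,
      sq_abs, real_inner_comm]
  rw [hexp] at hproj
  have ha : 0 < η ^ 2 * G ^ 2 * t := by positivity
  have hγ1 : η ^ 2 * G ^ 2 * t * γ = 1 / 2 := by rw [hγ]; field_simp
  have hγ2 : η ^ 2 * G ^ 2 * t * (γ ^ 2 * ‖v‖ ^ 2) ≤ 1 / 2 * t⁻¹ := by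
    have : η ^ 2 * G ^ 2 * t * (γ ^ 2 * ‖v‖ ^ 2) = ‖v‖ ^ 2 / (4 * (η ^ 2 * G ^ 2) * t) := by
      rw [hγ]; field_simp; ring
    rw [this, div_le_iff₀ (by positivity)]
    have : 1 / 2 * t⁻¹ * (4 * (η ^ 2 * G ^ 2) * t) = 2 * (η ^ 2 * G ^ 2) := by field_simp; norm_num
    rw [this]; exact hvn
  have h3 := mul_le_mul_of_nonneg_left hproj ha.le
  have h4 : η ^ 2 * G ^ 2 * t * (2 * (γ * inner ℝ v (x - u))) = inner ℝ v (x - u) := by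
    calc _ = 2 * (η ^ 2 * G ^ 2 * t * γ) * inner ℝ v (x - u) := by ring
      _ = _ := by rw [hγ1]; ring
  rw [hlin]
  linarith

/-- Regret of the Maler algorithm with gradients at most `G`, in terms of the squared distances
to the comparator. -/
theorem gridRate_mul_regret_le {K : Set (Vec d)} (hK : IsCompact K) (hKc : Convex ℝ K)
    (h0 : (0 : Vec d) ∈ K) {G D : ℝ} (hG : 0 < G) (hD : 0 < D)
    (hdiam : ∀ x ∈ K, ∀ y ∈ K, ‖x - y‖ ≤ D) {T : ℕ} (hT : 1 ≤ T) (f : ℕ → Vec d → ℝ)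
    (hf : ∀ n x, ‖gradient (f n) x‖ ≤ G) (i : Fin (gridSize T + 1)) {u : Vec d} (hu : u ∈ K) :
    gridRate G D i * ∑ n ∈ Finset.range T,
        inner ℝ (gradient (f n) (maler K G D T f n)) (maler K G D T f n - u)
      ≤ gridRate G D i ^ 2 * G ^ 2 * ∑ n ∈ Finset.range T, ‖maler K G D T f n - u‖ ^ 2
        + (-Real.log (gridPrior T i) + 1 / 2 * (1 + Real.log T)) := by
  set S := malerState K G D T f
  set η := gridRate G D i
  have hη : 0 < η := gridRate_pos hG hD i
  let g : ℕ → Vec d := fun n => gradient (f n) (maler K G D T f n)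
  let s : ℕ → Vec d → ℝ := fun n => surrS G η (g n) (maler K G D T f n)
  have hfeas := feasible_malerState hK h0 G D T f
  -- The normalizer never exceeds 1, so dividing by it can only raise a weight.
  have hweight : ∀ n, gridPrior T i *
      Real.exp (-∑ k ∈ Finset.range n, s k ((S k).xS i)) ≤ (S n).wS i := by
    intro n
    induction n with
    | zero => simp [S, malerState, malerInit]
    | succ n ih =>
      have hle := sum_weights_exp_neg_surr_le_one hKc hG hD hdiam hT (hfeas n)
        (hf n (maler K G D T f n))
      have hpos := sum_weights_exp_pos (hfeas n)
        (-surrC G D (convexRate G D T) (g n) (maler K G D T f n) (S n).xC)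
        (fun i => -surrS G (gridRate G D i) (g n) (maler K G D T f n) ((S n).xS i))
        (fun i => -surrL (gridRate G D i) (g n) (maler K G D T f n) ((S n).xL i))
      rw [Finset.sum_range_succ, neg_add, Real.exp_add, ← mul_assoc]
      refine (mul_le_mul_of_nonneg_right ih (Real.exp_pos _).le).trans ?_
      exact le_div_self (mul_pos ((hfeas n).wS_pos i) (Real.exp_pos _)).le hpos hle
  -- The distance term carries the factor n so that the one-step bounds, with coefficients t - 1 and
  -- t at t = n + 1, telescope.
  have hOGD : ∀ n : ℕ, ∑ k ∈ Finset.range n, (s k ((S k).xS i) - s k u)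
      ≤ 1 / 2 * (harmonic n : ℝ) - η ^ 2 * G ^ 2 * n * ‖(S n).xS i - u‖ ^ 2 := by
    intro n
    induction n with
    | zero => simp
    | succ n ih =>
      have hstep := surrS_sub_le hK hKc hG hdiam hη (gridRate_mul_le hG hD i)
        (hf n (maler K G D T f n)) (maler_mem hK hKc h0 hG hD hT f n) ((hfeas n).xS_mem i) hu
        (t := ((n + 1 : ℕ) : ℝ)) (by positivity)
      have hx : (S (n + 1)).xS i = genProj K 1 ((S n).xS i
          - (1 / (2 * η ^ 2 * G ^ 2 * ((n + 1 : ℕ) : ℝ))) •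
            gradS G η (g n) (maler K G D T f n) ((S n).xS i)) := by
        change genProj K 1 ((S n).xS i - (1 / (2 * η ^ 2 * G ^ 2 * (S n).round)) • _) = _
        rw [malerState_round K G D T f n]
        rfl
      rw [Finset.sum_range_succ, harmonic_succ, hx]
      push_cast at hstep ⊢
      linarith
  have hw1 : (S T).wS i ≤ 1 := by
    have h := (hfeas T).sum_eq
    have h1 := Finset.single_le_sum (f := fun i => (S T).wS i + (S T).wL i)
      (fun j _ => (add_pos ((hfeas T).wS_pos j) ((hfeas T).wL_pos j)).le) (Finset.mem_univ i)
    have h2 := (hfeas T).wC_pos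
    have h3 := (hfeas T).wL_pos i
    simp only [S] at *
    linarith
  have hlog := Real.log_le_log (mul_pos (gridPrior_pos T i) (Real.exp_pos _))
    ((hweight T).trans hw1)
  rw [Real.log_mul (gridPrior_pos T i).ne' (Real.exp_pos _).ne', Real.log_exp, Real.log_one] at hlog
  have hO := hOGD T
  have hH := harmonic_le_one_add_log T
  have hu' : ∑ k ∈ Finset.range T, s k u = -(η * ∑ k ∈ Finset.range T,
      inner ℝ (g k) (maler K G D T f k - u)) +
      η ^ 2 * G ^ 2 * ∑ k ∈ Finset.range T, ‖maler K G D T f k - u‖ ^ 2 := by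
    simp only [s, surrS]
    rw [Finset.sum_add_distrib, Finset.mul_sum, Finset.mul_sum, ← Finset.sum_neg_distrib]
    simp only [neg_mul]
  have hn : 0 ≤ η ^ 2 * G ^ 2 * T * ‖(S T).xS i - u‖ ^ 2 := by positivity
  rw [Finset.sum_sub_distrib, hu'] at hO
  linarith

end OCO

namespace OCO

/-! ### The ellipse -/

lemma mem_ellipse {lam : ℝ} {v : Vec 2} :
    v ∈ ellipse lam ↔ v 0 ^ 2 + v 1 ^ 2 / lam ^ 2 ≤ 1 := Iff.rfl

lemma norm_sq_vec_two (v : Vec 2) : ‖v‖ ^ 2 = v 0 ^ 2 + v 1 ^ 2 := by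
  rw [EuclideanSpace.norm_sq_eq, Fin.sum_univ_two]
  simp

lemma inner_vec_two (v w : Vec 2) : inner ℝ v w = v 0 * w 0 + v 1 * w 1 := by
  rw [PiLp.inner_apply, Fin.sum_univ_two]
  simp [mul_comm]

lemma sq_le_sq_div_sq {lam : ℝ} (h0 : 0 < lam) (h1 : lam < 1) (a : ℝ) :
    a ^ 2 ≤ a ^ 2 / lam ^ 2 := by
  rw [le_div_iff₀ (by positivity)]
  nlinarith [mul_nonneg (sq_nonneg a) (by nlinarith : 0 ≤ 1 - lam ^ 2)]

lemma norm_le_one_of_mem_ellipse {lam : ℝ} (h0 : 0 < lam) (h1 : lam < 1) {v : Vec 2}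
    (hv : v ∈ ellipse lam) : ‖v‖ ≤ 1 := by
  have h := sq_le_sq_div_sq h0 h1 (v 1)
  rw [mem_ellipse] at hv
  refine le_of_sq_le_sq ?_ zero_le_one
  rw [norm_sq_vec_two]
  linarith

lemma zero_mem_ellipse (lam : ℝ) : (0 : Vec 2) ∈ ellipse lam := by
  simp [mem_ellipse]

lemma isCompact_ellipse {lam : ℝ} (h0 : 0 < lam) (h1 : lam < 1) : IsCompact (ellipse lam) := by
  refine Metric.isCompact_of_isClosed_isBounded (isClosed_le (by fun_prop) continuous_const) ?_
  exact isBounded_iff_forall_norm_le.2 ⟨1, fun v hv => norm_le_one_of_mem_ellipse h0 h1 hv⟩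

lemma convex_ellipse (lam : ℝ) : Convex ℝ (ellipse lam) := by
  intro x hx y hy a b ha hb hab
  rw [mem_ellipse] at *
  have hsq : ∀ p q : ℝ, (a * p + b * q) ^ 2 ≤ a * p ^ 2 + b * q ^ 2 := by
    intro p q
    obtain rfl : b = 1 - a := by linarith
    nlinarith [mul_nonneg (mul_nonneg ha hb) (sq_nonneg (p - q))]
  have e0 : (a • x + b • y) 0 = a * x 0 + b * y 0 := by simp
  have e1 : (a • x + b • y) 1 = a * x 1 + b * y 1 := by simp
  rw [e0, e1]
  calc _ ≤ (a * x 0 ^ 2 + b * y 0 ^ 2) + (a * x 1 ^ 2 + b * y 1 ^ 2) / lam ^ 2 := by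
        gcongr
        · exact hsq _ _
        · exact hsq _ _
    _ = a * (x 0 ^ 2 + x 1 ^ 2 / lam ^ 2) + b * (y 0 ^ 2 + y 1 ^ 2 / lam ^ 2) := by ring
    _ ≤ a * 1 + b * 1 := by gcongr
    _ = 1 := by linarith

lemma diam_ellipse {lam : ℝ} (h0 : 0 < lam) (h1 : lam < 1) : Metric.diam (ellipse lam) = 2 := by
  apply le_antisymm
  · refine Metric.diam_le_of_forall_dist_le (by norm_num) fun x hx y hy => ?_
    have := dist_triangle_right x y 0
    rw [dist_zero_right, dist_zero_right] at this
    linarith [norm_le_one_of_mem_ellipse h0 h1 hx, norm_le_one_of_mem_ellipse h0 h1 hy]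
  · have hp : (!₂[1, 0] : Vec 2) ∈ ellipse lam := by simp [mem_ellipse]
    have hm : (!₂[-1, 0] : Vec 2) ∈ ellipse lam := by simp [mem_ellipse]
    have h := Metric.dist_le_diam_of_mem (isCompact_ellipse h0 h1).isBounded hp hm
    have e : dist (!₂[1, 0] : Vec 2) !₂[-1, 0] = 2 := by
      rw [EuclideanSpace.dist_eq]
      norm_num [Fin.sum_univ_two, Real.dist_eq]
    linarith

lemma norm_sub_le_diam_ellipse {lam : ℝ} (h0 : 0 < lam) (h1 : lam < 1) :
    ∀ x ∈ ellipse lam, ∀ y ∈ ellipse lam, ‖x - y‖ ≤ Metric.diam (ellipse lam) := by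
  intro x hx y hy
  rw [← dist_eq_norm]
  exact Metric.dist_le_diam_of_mem (isCompact_ellipse h0 h1).isBounded hx hy

/-- The curvature of the ellipse: linear functions grow quadratically away from their minimizer. -/
lemma exists_minimizer_ellipse {lam L : ℝ} (h0 : 0 < lam) (h1 : lam < 1) (hL : 0 < L) {v : Vec 2}
    (hv : v 1 ^ 2 = L ^ 2) : ∃ u ∈ ellipse lam, ∀ z ∈ ellipse lam,
      lam * L / 2 * ‖z - u‖ ^ 2 ≤ inner ℝ v (z - u) := by
  -- Scaling the second axis turns the ellipse into the unit disc; there v becomes (v 0, λ v 1), of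
  -- length m ≥ λL, and the minimizer is the unit vector (p, q) opposite to it.
  set m := Real.sqrt (v 0 ^ 2 + lam ^ 2 * v 1 ^ 2)
  have hm2 : m ^ 2 = v 0 ^ 2 + lam ^ 2 * v 1 ^ 2 := Real.sq_sqrt (by positivity)
  have hmL : lam * L ≤ m := Real.le_sqrt_of_sq_le (by nlinarith [sq_nonneg (v 0)])
  have hm : 0 < m := lt_of_lt_of_le (by positivity) hmL
  obtain ⟨p, hp⟩ : ∃ p, p = -v 0 / m := ⟨_, rfl⟩
  obtain ⟨q, hq⟩ : ∃ q, q = -(lam * v 1) / m := ⟨_, rfl⟩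
  have hpq : p ^ 2 + q ^ 2 = 1 := by
    rw [hp, hq]; field_simp; linarith
  have hv0 : v 0 = -(m * p) := by rw [hp]; field_simp
  have hv1 : v 1 = -(m * q) / lam := by rw [hq]; field_simp
  refine ⟨!₂[p, lam * q], ?_, fun z hz => ?_⟩
  · rw [mem_ellipse]
    have : p ^ 2 + (lam * q) ^ 2 / lam ^ 2 = 1 := by rw [← hpq]; field_simp
    exact this.le
  · obtain ⟨y, hy⟩ : ∃ y, z 1 = lam * y := ⟨z 1 / lam, by field_simp⟩
    rw [mem_ellipse, hy, mul_pow, mul_div_cancel_left₀ _ (by positivity)] at hz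
    have hin : inner ℝ v (z - !₂[p, lam * q]) = m * (1 - (p * z 0 + q * y)) := by
      rw [inner_vec_two, hv0, hv1, ← hpq]
      simp [hy]
      field_simp
      ring
    have hno : ‖z - !₂[p, lam * q]‖ ^ 2 = (z 0 - p) ^ 2 + lam ^ 2 * (y - q) ^ 2 := by
      rw [norm_sq_vec_two]
      simp [hy]
      ring
    -- As λ < 1, the squared distance is at most the one in the disc, which is at most 2 - 2(p · z 0
    -- + q · y).
    have hle : ‖z - !₂[p, lam * q]‖ ^ 2 ≤ 2 * (1 - (p * z 0 + q * y)) := by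
      rw [hno]
      nlinarith [mul_nonneg (sq_nonneg (y - q)) (by nlinarith : 0 ≤ 1 - lam ^ 2)]
    have hnn : 0 ≤ 1 - (p * z 0 + q * y) := by nlinarith [sq_nonneg ‖z - !₂[p, lam * q]‖]
    rw [hin]
    calc _ ≤ lam * L / 2 * (2 * (1 - (p * z 0 + q * y))) := by gcongr
      _ = lam * L * (1 - (p * z 0 + q * y)) := by ring
      _ ≤ _ := by gcongr

/-! ### Tuning the learning rate -/

lemma le_four_pow_gridSize {T : ℕ} (hT : 1 ≤ T) : (T : ℝ) ≤ 4 ^ gridSize T := by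
  have hT0 : (0 : ℝ) < T := by exact_mod_cast hT
  have h := Nat.le_ceil (Real.logb 2 T / 2)
  rw [show (4 : ℝ) = 2 ^ 2 by norm_num, ← pow_mul, ← Real.rpow_natCast,
    ← Real.logb_le_iff_le_rpow (by norm_num) hT0]
  push_cast
  unfold gridSize
  linarith

lemma four_pow_gridSize_le {T : ℕ} (hT : 1 ≤ T) : (4 : ℝ) ^ gridSize T ≤ 4 * T := by
  have hT0 : (0 : ℝ) < T := by exact_mod_cast hT
  have h := Nat.ceil_lt_add_one (a := Real.logb 2 T / 2)
    (div_nonneg (Real.logb_nonneg (by norm_num) (by exact_mod_cast hT)) (by norm_num))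
  have e : (4 : ℝ) * T = 2 ^ (2 + Real.logb 2 T) := by
    rw [Real.rpow_add (by norm_num), Real.rpow_logb (by norm_num) (by norm_num) hT0]; norm_num
  rw [e, show (4 : ℝ) = 2 ^ 2 by norm_num, ← pow_mul, ← Real.rpow_natCast]
  apply Real.rpow_le_rpow_of_exponent_le (by norm_num)
  push_cast
  unfold gridSize
  linarith

/-- The crude bound N + 1 ≤ 2^N makes the prior at least 1/(24T), and a logarithmic cost is
affordable here. -/
lemma neg_log_gridPrior_le {T : ℕ} (hT : 2 ≤ T) (i : Fin (gridSize T + 1)) :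
    -Real.log (gridPrior T i) + 1 / 2 * (1 + Real.log T) ≤ 8 * Real.log T := by
  have hT0 : (0 : ℝ) < T := by exact_mod_cast (by omega : 0 < T)
  have hlogT : Real.log 2 ≤ Real.log T :=
    Real.log_le_log (by norm_num) (by exact_mod_cast hT)
  have h2 := Real.log_two_gt_d9
  have hprior : (24 * (T : ℝ))⁻¹ ≤ gridPrior T i := by
    have hi : ((i : ℕ) : ℝ) ≤ gridSize T := by exact_mod_cast Nat.lt_succ_iff.1 i.2
    have hN1 : (gridSize T : ℝ) + 1 ≤ 2 ^ gridSize T := by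
      exact_mod_cast Nat.lt_two_pow_self
    have hone : (1 : ℝ) ≤ 2 ^ gridSize T := one_le_pow₀ (by norm_num)
    have hden : 3 * (((i : ℕ) : ℝ) + 1) * (((i : ℕ) : ℝ) + 2) ≤ 24 * T := by
      calc 3 * (((i : ℕ) : ℝ) + 1) * (((i : ℕ) : ℝ) + 2)
          ≤ 3 * (2 ^ gridSize T) * (2 * 2 ^ gridSize T) := by
            gcongr <;> linarith
        _ = 6 * 4 ^ gridSize T := by
            rw [show (4 : ℝ) = 2 * 2 by norm_num, mul_pow]; ring
        _ ≤ 24 * T := by linarith [four_pow_gridSize_le (T := T) (by omega)]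
    unfold gridPrior
    rw [inv_eq_one_div]
    apply div_le_div₀ (by positivity) _ (by positivity) hden
    have : (0 : ℝ) ≤ 1 / (1 + (gridSize T : ℝ)) := by positivity
    linarith
  have h := Real.log_le_log (by positivity) hprior
  rw [Real.log_inv, Real.log_mul (by norm_num) hT0.ne'] at h
  have h24 : Real.log 24 ≤ 5 * Real.log 2 := by
    rw [← Real.log_rpow (by norm_num)]
    exact Real.log_le_log (by norm_num) (by norm_num)
  linarith

/-- If some rate of the grid is of the order of `b / G ^ 2`, it gives the fast rate; the extreme
rates cover the remaining cases. -/
lemma le_of_forall_gridRate {T : ℕ} (hT : 1 ≤ T) {G b R V A : ℝ} (hG : 0 < G) (hb : 0 < b)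
    (hA : 0 ≤ A) (hV0 : 0 ≤ V) (hV : b / 2 * V ≤ R) (hVT : V ≤ 4 * T)
    (h : ∀ i : Fin (gridSize T + 1), gridRate G 2 i * R ≤ gridRate G 2 i ^ 2 * G ^ 2 * V + A) :
    R ≤ 16 * (A + 1) * G ^ 2 / b + 10 * (G * 2) * A := by
  have hR : 0 ≤ R := le_trans (by positivity) hV
  -- At or below this rate, half of ηR absorbs the quadratic term, since V ≤ 2R/b.
  obtain ⟨θ, hθ⟩ : ∃ θ, θ = b / (4 * G ^ 2) := ⟨_, rfl⟩
  have hθ0 : 0 < θ := by rw [hθ]; positivity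
  have hθb : θ * (G ^ 2 * V) ≤ R / 2 := by
    have : θ * (G ^ 2 * V) = b / 2 * V / 2 := by rw [hθ]; field_simp; ring
    linarith
  have conv : ∀ c, c ≤ 4 * (A + 1) → θ * R ≤ c →
      R ≤ 16 * (A + 1) * G ^ 2 / b + 10 * (G * 2) * A := by
    intro c hc h
    have h1 : R ≤ 16 * (A + 1) * G ^ 2 / b := by
      rw [le_div_iff₀ hb]
      have hb' : b = θ * (4 * G ^ 2) := by rw [hθ]; field_simp
      calc R * b = θ * R * (4 * G ^ 2) := by rw [hb']; ring
        _ ≤ 4 * (A + 1) * (4 * G ^ 2) :=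
            mul_le_mul_of_nonneg_right (h.trans hc) (by positivity)
        _ = _ := by ring
    have : 0 ≤ 10 * (G * 2) * A := by positivity
    linarith
  have small : ∀ i : Fin (gridSize T + 1), gridRate G 2 i ≤ θ → gridRate G 2 i * R ≤ 2 * A := by
    intro i hi
    have hη := gridRate_pos hG (by norm_num : (0 : ℝ) < 2) i
    have h1 : gridRate G 2 i ^ 2 * G ^ 2 * V ≤ gridRate G 2 i * (R / 2) := by
      rw [sq, mul_assoc, mul_assoc]
      refine mul_le_mul_of_nonneg_left (le_trans ?_ hθb) hη.le
      gcongr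
    linarith [h i]
  -- Take the largest grid rate that is at most θ. If it is the top rate 1/(10G), the second summand
  -- bounds R; otherwise its predecessor exceeds θ, so it exceeds θ/2. If no rate is at most θ, the
  -- smallest rate still works, because V ≤ 4T makes its quadratic term at most 1.
  by_cases hex : ∃ i : ℕ, i ≤ gridSize T ∧ gridRate G 2 i ≤ θ
  · classical
    obtain ⟨hiN, hi⟩ := Nat.find_spec hex
    have hs := small ⟨Nat.find hex, by omega⟩ hi
    simp only at hs
    rcases hi0 : Nat.find hex with _ | j
    · rw [hi0] at hs
      have hr : R = 10 * G * (gridRate G 2 0 * R) := by unfold gridRate; field_simp; ring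
      have h1 : R ≤ 10 * (G * 2) * A := by
        rw [hr]
        nlinarith
      have : 0 ≤ 16 * (A + 1) * G ^ 2 / b := by positivity
      linarith
    · rw [hi0] at hs
      have hj : θ < gridRate G 2 j := by
        by_contra hcon
        exact Nat.find_min hex (m := j) (by omega) ⟨by omega, not_lt.1 hcon⟩
      have hr : gridRate G 2 (j + 1) = gridRate G 2 j / 2 := by
        unfold gridRate; rw [pow_succ]; field_simp
      rw [hr] at hs
      refine conv (4 * A) (by linarith) ?_
      have := mul_le_mul_of_nonneg_right hj.le hR
      linarith
  · have hN : θ < gridRate G 2 (gridSize T) := by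
      by_contra hcon
      exact hex ⟨_, le_rfl, not_lt.1 hcon⟩
    have hl := h (Fin.last _)
    rw [Fin.val_last] at hl
    refine conv (A + 1) (by linarith)
      ((mul_le_mul_of_nonneg_right hN.le hR).trans (hl.trans ?_))
    have e : gridRate G 2 (gridSize T) ^ 2 * G ^ 2 = 1 / (100 * 4 ^ gridSize T) := by
      have : (4 : ℝ) ^ gridSize T = (2 ^ gridSize T) ^ 2 := by
        rw [← pow_mul, mul_comm, pow_mul]; norm_num
      rw [this]; unfold gridRate; field_simp; norm_num
    have hT4 := le_four_pow_gridSize hT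
    have : gridRate G 2 (gridSize T) ^ 2 * G ^ 2 * V ≤ 1 := by
      rw [e, one_div_mul_eq_div, div_le_one (by positivity)]
      have : (0 : ℝ) < 4 ^ gridSize T := by positivity
      linarith
    linarith

/-! ### Sequences of Bernoulli trials -/

/-- The probability of the outcome `x` of independent Bernoulli trials with parameter `p`. -/
def trialWeight {T : ℕ} (p : ℝ) (x : Fin T → Bool) : ℝ := ∏ i, if x i then p else 1 - p

lemma trialWeight_nonneg {T : ℕ} {p : ℝ} (hp : p ∈ Set.Icc (0 : ℝ) 1) (x : Fin T → Bool) :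
    0 ≤ trialWeight p x :=
  Finset.prod_nonneg fun i _ => by split_ifs <;> linarith [hp.1, hp.2]

lemma sum_trialWeight (T : ℕ) (p : ℝ) : ∑ x : Fin T → Bool, trialWeight p x = 1 := by
  have h := Finset.prod_univ_sum (fun _ : Fin T => (Finset.univ : Finset Bool))
    (fun _ b => if b then p else 1 - p)
  rw [Fintype.piFinset_univ] at h
  unfold trialWeight
  rw [← h]
  simp

/-- The outcome of a trial is independent of everything that does not depend on it. -/
lemma sum_trialWeight_mul {T : ℕ} (p : ℝ) (t : Fin T) (c : Bool → ℝ) (ψ : (Fin T → Bool) → ℝ)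
    (hψ : ∀ x b, ψ (Function.update x t b) = ψ x) :
    ∑ x, trialWeight p x * (c (x t) * ψ x)
      = ∑ x, trialWeight p x * ((p * c true + (1 - p) * c false) * ψ x) := by
  -- Flipping trial t pairs the outcomes; on each pair the other factors and ψ agree, so both sides
  -- reduce to the same two-term average.
  let σ : (Fin T → Bool) → (Fin T → Bool) := fun x => Function.update x t (!x t)
  have hσ : Function.Involutive σ := fun x => by simp [σ]
  let r : (Fin T → Bool) → ℝ := fun x => ∏ i ∈ Finset.univ.erase t, if x i then p else 1 - p
  have hw : ∀ x, trialWeight p x = (if x t then p else 1 - p) * r x := fun x =>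
    (Finset.mul_prod_erase _ _ (Finset.mem_univ t)).symm
  have hr : ∀ x, r (σ x) = r x := fun x => Finset.prod_congr rfl fun i hi => by
    simp [σ, Function.update_of_ne (Finset.ne_of_mem_erase hi)]
  have hsum : ∀ F : (Fin T → Bool) → ℝ, ∑ x, F (σ x) = ∑ x, F x := fun F =>
    Equiv.sum_comp hσ.toPerm F
  have hψσ : ∀ x, ψ (σ x) = ψ x := fun x => hψ x _
  have hσt : ∀ x, σ x t = !x t := fun x => by simp [σ]
  have two : ∀ F : (Fin T → Bool) → ℝ, 2 * ∑ x, F x = ∑ x, (F x + F (σ x)) := fun F => by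
    rw [Finset.sum_add_distrib, hsum, two_mul]
  refine mul_left_cancel₀ (two_ne_zero (α := ℝ)) ?_
  rw [two, two]
  refine Finset.sum_congr rfl fun x _ => ?_
  rw [hw, hw, hr, hψσ, hσt]
  cases x t <;> simp <;> ring

/-- The coordinates of a finite sequence of outcomes. -/
def trial (T : ℕ) (n : ℕ) (x : Fin T → Bool) : Bool := if h : n < T then x ⟨n, h⟩ else false

lemma trial_val {T : ℕ} (t : Fin T) (x : Fin T → Bool) : trial T t x = x t := by
  simp [trial]

/-! ### The regret for a known success probability -/

lemma gradient_envLoss {Ω : Type*} (s L : ℝ) (X : ℕ → Ω → Bool) (ω : Ω) (t : ℕ) (x : Vec 2) :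
    gradient (envLoss s L X ω t) x = lossVec s L (X t ω) := by
  apply HasGradientAt.gradient
  rw [hasGradientAt_iff_hasFDerivAt]
  exact (InnerProductSpace.toDual ℝ (Vec 2) (lossVec s L (X t ω))).hasFDerivAt

lemma norm_lossVec {s : ℝ} (hs : s = 1 ∨ s = -1) (L : ℝ) (b : Bool) :
    ‖lossVec s L b‖ = Real.sqrt (1 + L ^ 2) := by
  rw [← Real.sqrt_sq (norm_nonneg (lossVec s L b)), norm_sq_vec_two]
  congr 1
  rcases hs with rfl | rfl <;> cases b <;> simp [lossVec] <;> norm_num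

/-- Allowing two sample spaces serves both purposes: predictability on the finite cube, and transfer
of the algorithm from Ω to that cube. -/
lemma envPlay_congr {Ω Ω' : Type*} (lam s L G : ℝ) (T : ℕ) {X : ℕ → Ω → Bool}
    {X' : ℕ → Ω' → Bool} {ω : Ω} {ω' : Ω'} {t : ℕ} (h : ∀ k < t, X k ω = X' k ω') :
    envPlay lam s L G T X ω t = envPlay lam s L G T X' ω' t := by
  unfold envPlay maler
  rw [malerState_congr]
  intro k hk
  funext x
  simp only [envLoss, h k hk]

/-- The conditional mean of the loss vectors. -/
def meanLossVec (s L p : ℝ) : Vec 2 := !₂[2 * p - 1, -(s * L)]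

lemma sum_trialWeight_mul_inner {T : ℕ} (s L p : ℝ) (t : Fin T) (y : (Fin T → Bool) → Vec 2)
    (hy : ∀ x b, y (Function.update x t b) = y x) :
    ∑ x, trialWeight p x * inner ℝ (lossVec s L (x t)) (y x)
      = ∑ x, trialWeight p x * inner ℝ (meanLossVec s L p) (y x) := by
  have h := sum_trialWeight_mul p t (fun b => lossVec s L b 0) (fun x => y x 0)
    (fun x b => by rw [hy])
  simp only [inner_vec_two, mul_add, Finset.sum_add_distrib]
  congr 1
  · rw [h]
    refine Finset.sum_congr rfl fun x _ => ?_
    simp [lossVec, meanLossVec]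
    ring_nf
    simp

lemma pathRegret_envLoss {Ω : Type*} (s L : ℝ) (X : ℕ → Ω → Bool) (ω : Ω) (T : ℕ)
    (x : ℕ → Vec 2) (z : Vec 2) : pathRegret T (envLoss s L X ω) x z
      = ∑ t ∈ Finset.range T, inner ℝ (lossVec s L (X t ω)) (x t - z) := by
  simp only [pathRegret, envLoss, inner_sub_right]

/-- For fixed p this joins curvature, the pathwise bound and the tuning of the rate. The right side
is free of p, which permits averaging over P. -/
lemma expected_pathRegret_le {lam L s G p : ℝ} {T : ℕ} (h0 : 0 < lam) (h1 : lam < 1) (hL : 0 < L)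
    (hs : s = 1 ∨ s = -1) (hG : Real.sqrt (1 + L ^ 2) ≤ G) (hT : 2 ≤ T)
    (hp : p ∈ Set.Icc (0 : ℝ) 1) {z : Vec 2} (hz : z ∈ ellipse lam) :
    ∑ x, trialWeight p x * pathRegret T (envLoss s L (trial T) x)
        (envPlay lam s L G T (trial T) x) z
      ≤ 16 * (8 * Real.log T + 1) * G ^ 2 / (lam * L) + 10 * (G * 2) * (8 * Real.log T) := by
  have hG0 : 0 < G := lt_of_lt_of_le (Real.sqrt_pos.2 (by positivity)) hG
  have hT1 : 1 ≤ T := by omega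
  have hdiam := norm_sub_le_diam_ellipse h0 h1
  have hD := diam_ellipse h0 h1
  have hlog : 0 ≤ Real.log T := Real.log_natCast_nonneg T
  obtain ⟨u, hu, hcurv⟩ := exists_minimizer_ellipse h0 h1 hL (v := meanLossVec s L p)
    (by rcases hs with rfl | rfl <;> simp [meanLossVec])
  set v := meanLossVec s L p
  let y : (Fin T → Bool) → ℕ → Vec 2 := fun x => envPlay lam s L G T (trial T) x
  have hyE : ∀ x n, y x n ∈ ellipse lam := fun x n =>
    maler_mem (isCompact_ellipse h0 h1) (convex_ellipse lam) (zero_mem_ellipse lam) hG0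
      (by rw [hD]; norm_num) hT1 _ n
  have hw := trialWeight_nonneg (T := T) hp
  have hpred : ∀ (t : Fin T) (x : Fin T → Bool) (b : Bool),
      y (Function.update x t b) t = y x t := fun t x b => envPlay_congr _ _ _ _ _ fun k hk => by
    have hkT : k < T := hk.trans t.2
    simp only [trial, hkT, dif_pos]
    exact Function.update_of_ne (Fin.ne_of_lt hk) _ _
  have hmean : ∀ z : Vec 2, ∑ x, trialWeight p x * pathRegret T (envLoss s L (trial T) x) (y x) z
      = ∑ x, trialWeight p x * ∑ t ∈ Finset.range T, inner ℝ v (y x t - z) := by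
    intro z
    simp only [pathRegret_envLoss, Finset.mul_sum]
    rw [Finset.sum_comm, Finset.sum_comm (s := Finset.univ)]
    refine Finset.sum_congr rfl fun t ht => ?_
    have h := sum_trialWeight_mul_inner s L p ⟨t, Finset.mem_range.1 ht⟩ (fun x => y x t - z)
      (fun x b => by rw [hpred ⟨t, Finset.mem_range.1 ht⟩])
    rw [← h]
    exact Finset.sum_congr rfl fun x _ => by rw [← trial_val ⟨t, Finset.mem_range.1 ht⟩ x]
  set R := ∑ x, trialWeight p x * pathRegret T (envLoss s L (trial T) x) (y x) u with hR
  set V := ∑ x, trialWeight p x * ∑ t ∈ Finset.range T, ‖y x t - u‖ ^ 2 with hV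
  -- The curvature inequality is available at u, which depends on p, so z is replaced by u;
  -- optimality of u for the mean loss gives the right direction.
  have hle : ∑ x, trialWeight p x * pathRegret T (envLoss s L (trial T) x) (y x) z ≤ R := by
    rw [hR, hmean, hmean]
    refine Finset.sum_le_sum fun x _ => mul_le_mul_of_nonneg_left
      (Finset.sum_le_sum fun t _ => ?_) (hw x)
    have h2 : 0 ≤ lam * L / 2 * ‖z - u‖ ^ 2 := by positivity
    have h3 := hcurv z hz
    simp only [inner_sub_right] at h3 ⊢
    linarith
  have hVR : lam * L / 2 * V ≤ R := by
    rw [hR, hmean, hV, Finset.mul_sum]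
    refine Finset.sum_le_sum fun x _ => ?_
    rw [mul_left_comm, Finset.mul_sum]
    exact mul_le_mul_of_nonneg_left (Finset.sum_le_sum fun t _ => hcurv _ (hyE x t)) (hw x)
  have hV0 : 0 ≤ V := Finset.sum_nonneg fun x _ =>
    mul_nonneg (hw x) (Finset.sum_nonneg fun t _ => sq_nonneg _)
  have hVT : V ≤ 4 * T := by
    calc V ≤ ∑ x : Fin T → Bool, trialWeight p x * (4 * T) := by
          refine Finset.sum_le_sum fun x _ => mul_le_mul_of_nonneg_left ?_ (hw x)
          calc _ ≤ ∑ t ∈ Finset.range T, (4 : ℝ) := Finset.sum_le_sum fun t _ => by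
                have h := pow_le_pow_left₀ (norm_nonneg _) (hdiam _ (hyE x t) u hu) 2
                rw [hD] at h
                linarith
            _ = 4 * T := by simp [mul_comm]
      _ = 4 * T := by rw [← Finset.sum_mul, sum_trialWeight, one_mul]
  refine hle.trans (le_of_forall_gridRate hT1 hG0 (by positivity) (by positivity) hV0 hVR hVT ?_)
  intro i
  have hpath : ∀ x, gridRate G 2 i * pathRegret T (envLoss s L (trial T) x) (y x) u
      ≤ gridRate G 2 i ^ 2 * G ^ 2 * ∑ t ∈ Finset.range T, ‖y x t - u‖ ^ 2 + 8 * Real.log T := by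
    intro x
    have h := gridRate_mul_regret_le (isCompact_ellipse h0 h1) (convex_ellipse lam)
      (zero_mem_ellipse lam) hG0 (by rw [hD]; norm_num) hdiam hT1 (envLoss s L (trial T) x)
      (fun n z => by rw [gradient_envLoss, norm_lossVec hs]; exact hG) i hu
    simp only [gradient_envLoss] at h
    rw [pathRegret_envLoss]
    have h' := neg_log_gridPrior_le hT i
    simp only [hD] at h
    simp only [y, envPlay, hD]
    linarith
  calc gridRate G 2 i * R = ∑ x, trialWeight p x *
        (gridRate G 2 i * pathRegret T (envLoss s L (trial T) x) (y x) u) := by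
        rw [hR, Finset.mul_sum]; exact Finset.sum_congr rfl fun x _ => by ring
    _ ≤ ∑ x, trialWeight p x * (gridRate G 2 i ^ 2 * G ^ 2 *
          ∑ t ∈ Finset.range T, ‖y x t - u‖ ^ 2 + 8 * Real.log T) :=
        Finset.sum_le_sum fun x _ => mul_le_mul_of_nonneg_left (hpath x) (hw x)
    _ = gridRate G 2 i ^ 2 * G ^ 2 * V + 8 * Real.log T := by
        simp only [mul_add, Finset.sum_add_distrib]
        rw [← Finset.sum_mul, sum_trialWeight, one_mul, hV, Finset.mul_sum]
        congr 1
        exact Finset.sum_congr rfl fun x _ => by ring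

end OCO

namespace OCO

/-! ### Mixtures of Bernoulli trials -/

lemma ae_betaMeasure_mem_Icc (a b : ℝ) : ∀ᵐ p ∂betaMeasure a b, p ∈ Set.Icc (0 : ℝ) 1 := by
  have hm : Measurable (betaPDF a b) := (measurable_betaPDFReal a b).ennreal_ofReal
  rw [betaMeasure, ae_withDensity_iff hm]
  refine Filter.Eventually.of_forall fun p hp => ?_
  by_contra hcon
  rw [Set.mem_Icc, not_and_or, not_le, not_le] at hcon
  rcases hcon with h | h
  · exact hp (betaPDF_eq_zero_of_nonpos h.le)
  · exact hp (betaPDF_eq_zero_of_one_le h.le)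

lemma betaPDF_one_sub (k p : ℝ) : betaPDF k k (1 - p) = betaPDF k k p := by
  rw [betaPDF_eq, betaPDF_eq, sub_sub_cancel]
  congr 1
  have : (0 < 1 - p ∧ 1 - p < 1) ↔ (0 < p ∧ p < 1) := by
    constructor <;> rintro ⟨h, h'⟩ <;> constructor <;> linarith
  simp only [this]
  split_ifs <;> ring

/-- The density is symmetric under p ↦ 1 - p and 2p - 1 is odd, so the integral equals its own
negative. -/
lemma integral_betaMeasure_self (k : ℝ) : ∫ p, (2 * p - 1) ∂betaMeasure k k = 0 := by
  have hm : Measurable (betaPDF k k) := (measurable_betaPDFReal k k).ennreal_ofReal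
  rw [betaMeasure, integral_withDensity_eq_integral_toReal_smul hm
    (Filter.Eventually.of_forall fun _ => ENNReal.ofReal_lt_top)]
  have h := integral_sub_left_eq_self
    (fun p : ℝ => (betaPDF k k p).toReal • (2 * p - 1)) volume 1
  have e : ∀ p : ℝ, (betaPDF k k (1 - p)).toReal • (2 * (1 - p) - 1)
      = -((betaPDF k k p).toReal • (2 * p - 1)) := by
    intro p
    rw [betaPDF_one_sub, ← smul_neg]
    congr 1
    ring
  simp only [e, integral_neg] at h
  linarith

section Mixture

variable {Ω : Type*} [MeasurableSpace Ω] {μ : Measure Ω} {P : Ω → ℝ}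
  {X : ℕ → Ω → Bool} {T : ℕ}

lemma continuous_trialWeight (x : Fin T → Bool) : Continuous fun p => trialWeight p x := by
  unfold trialWeight
  refine continuous_finsetProd _ fun i _ => ?_
  split_ifs <;> fun_prop

lemma integrable_trialWeight {ν : Measure ℝ} [IsProbabilityMeasure ν]
    (hν : ∀ᵐ p ∂ν, p ∈ Set.Icc (0 : ℝ) 1) (x : Fin T → Bool) :
    Integrable (fun p => trialWeight p x) ν := by
  refine Integrable.of_bound (continuous_trialWeight x).aestronglyMeasurable 1 ?_
  filter_upwards [hν] with p hp
  rw [Real.norm_of_nonneg (trialWeight_nonneg hp x), ← sum_trialWeight T p]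
  exact Finset.single_le_sum (fun y _ => trialWeight_nonneg hp y) (Finset.mem_univ x)

lemma IsBernoulliMixture.measurable_trials (h : IsBernoulliMixture μ P X T) :
    Measurable fun ω (i : Fin T) => X i ω :=
  measurable_pi_lambda _ fun i => h.measurable_X i i.2

lemma IsBernoulliMixture.integrable_comp [IsProbabilityMeasure μ]
    (h : IsBernoulliMixture μ P X T)
    (F : (Fin T → Bool) → ℝ) : Integrable (fun ω => F fun i => X i ω) μ := by
  have : IsProbabilityMeasure (μ.map fun ω (i : Fin T) => X i ω) :=
    Measure.isProbabilityMeasure_map h.measurable_trials.aemeasurable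
  exact (Integrable.of_finite (f := F)).comp_measurable h.measurable_trials

/-- The support condition makes all factors nonnegative, so the truncations by `ENNReal.ofReal` in
the joint law are harmless. -/
lemma IsBernoulliMixture.real_trials (h : IsBernoulliMixture μ P X T)
    (hν : ∀ᵐ p ∂μ.map P, p ∈ Set.Icc (0 : ℝ) 1) (x : Fin T → Bool) :
    (μ.map fun ω (i : Fin T) => X i ω).real {x} = ∫ p, trialWeight p x ∂μ.map P := by
  have hlaw := h.joint_law Set.univ MeasurableSet.univ x
  rw [Measure.restrict_univ] at hlaw
  have hset : (fun ω (i : Fin T) => X i ω) ⁻¹' {x}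
      = {ω | P ω ∈ Set.univ ∧ ∀ i : Fin T, X i ω = x i} := by
    ext ω; simp [funext_iff]
  rw [Measure.real, Measure.map_apply h.measurable_trials (measurableSet_singleton x), hset, hlaw,
    integral_eq_lintegral_of_nonneg_ae
      (by filter_upwards [hν] with p hp using trialWeight_nonneg hp x)
      (continuous_trialWeight x).aestronglyMeasurable]
  congr 1
  refine lintegral_congr_ae ?_
  filter_upwards [hν] with p hp
  rw [trialWeight, ENNReal.ofReal_prod_of_nonneg]
  intro i _
  split_ifs <;> linarith [hp.1, hp.2]

/-- Disintegration over P: expectations of functions of the trials become averages over p of the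
finite sums bounded earlier. -/
lemma IsBernoulliMixture.integral_comp [IsProbabilityMeasure μ]
    (h : IsBernoulliMixture μ P X T)
    (hν : ∀ᵐ p ∂μ.map P, p ∈ Set.Icc (0 : ℝ) 1) (F : (Fin T → Bool) → ℝ) :
    Integrable (fun p => ∑ x, trialWeight p x * F x) (μ.map P) ∧
    ∫ ω, F (fun i => X i ω) ∂μ = ∫ p, ∑ x, trialWeight p x * F x ∂μ.map P := by
  have : IsProbabilityMeasure (μ.map fun ω (i : Fin T) => X i ω) :=
    Measure.isProbabilityMeasure_map h.measurable_trials.aemeasurable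
  have : IsProbabilityMeasure (μ.map P) :=
    Measure.isProbabilityMeasure_map h.measurable_P.aemeasurable
  have hint : ∀ x ∈ Finset.univ, Integrable (fun p => trialWeight p x * F x) (μ.map P) :=
    fun x _ => (integrable_trialWeight hν x).mul_const _
  refine ⟨integrable_finsetSum _ hint, ?_⟩
  have hmap := integral_map (μ := μ) h.measurable_trials.aemeasurable (f := F)
    (Measurable.of_discrete.aestronglyMeasurable)
  rw [← hmap, integral_fintype Integrable.of_finite, integral_finsetSum _ hint]
  refine Finset.sum_congr rfl fun x _ => ?_
  rw [h.real_trials hν, integral_mul_const, smul_eq_mul]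

/-- The expected cumulative loss of a fixed point, for success probabilities with mean `1 / 2`. -/
lemma IsBernoulliMixture.integral_sum_envLoss [IsProbabilityMeasure μ]
    (h : IsBernoulliMixture μ P X T)
    (hν : ∀ᵐ p ∂μ.map P, p ∈ Set.Icc (0 : ℝ) 1) (hmean : ∫ p, (2 * p - 1) ∂μ.map P = 0)
    (s L : ℝ) (z : Vec 2) :
    ∫ ω, ∑ t ∈ Finset.range T, envLoss s L X ω t z ∂μ = T * (-(s * L) * z 1) := by
  have : IsProbabilityMeasure (μ.map P) :=
    Measure.isProbabilityMeasure_map h.measurable_P.aemeasurable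
  have hsum : ∀ ω, ∑ t ∈ Finset.range T, envLoss s L X ω t z
      = ∑ t : Fin T, inner ℝ (lossVec s L (X t ω)) z := fun ω =>
    (Fin.sum_univ_eq_sum_range (fun t => inner ℝ (lossVec s L (X t ω)) z) T).symm
  simp only [hsum]
  rw [(h.integral_comp hν fun x => ∑ t, inner ℝ (lossVec s L (x t)) z).2]
  have hp : ∀ p : ℝ, ∑ x : Fin T → Bool, trialWeight p x * ∑ t, inner ℝ (lossVec s L (x t)) z
      = T * z 0 * (2 * p - 1) + T * (-(s * L) * z 1) := by
    intro p
    simp only [Finset.mul_sum]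
    rw [Finset.sum_comm]
    simp only [sum_trialWeight_mul_inner s L p _ (fun _ => z) (fun _ _ => rfl)]
    simp only [← Finset.sum_mul, sum_trialWeight, inner_vec_two, meanLossVec]
    simp
    ring
  have hi : Integrable (fun p : ℝ => 2 * p - 1) (μ.map P) := by
    refine Integrable.of_bound (by fun_prop) 1 ?_
    filter_upwards [hν] with p hp
    rw [Real.norm_eq_abs, abs_le]
    constructor <;> linarith [hp.1, hp.2]
  simp only [hp]
  rw [integral_add (hi.const_mul _) (integrable_const _), integral_const_mul, hmean]
  simp

end Mixture

/-! ### The comparator x⋆ -/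

lemma xStar_mem_ellipse {lam s : ℝ} (h0 : 0 < lam) (hs : s = 1 ∨ s = -1) :
    xStar s lam ∈ ellipse lam := by
  rw [mem_ellipse]
  rcases hs with rfl | rfl <;> simp [xStar, h0.ne']

/-- A point with s · z 1 ≥ λ exhausts the ellipse inequality with its second coordinate, which
forces z 0 = 0 and z 1 = sλ. Only this coordinate enters the expected loss. -/
lemma mul_lt_of_ne_xStar {lam s : ℝ} (h0 : 0 < lam) (hs : s = 1 ∨ s = -1) {z : Vec 2}
    (hz : z ∈ ellipse lam) (hne : z ≠ xStar s lam) : s * z 1 < lam := by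
  rw [mem_ellipse] at hz
  have hs2 : s * s = 1 := by rcases hs with rfl | rfl <;> norm_num
  by_contra hcon
  rw [not_lt] at hcon
  have h1 : lam ^ 2 ≤ z 1 ^ 2 := by
    have := pow_le_pow_left₀ h0.le hcon 2
    nlinarith
  have h2 : 1 ≤ z 1 ^ 2 / lam ^ 2 := (one_le_div (by positivity)).2 h1
  have h3 : z 0 = 0 := by
    have : z 0 ^ 2 = 0 := le_antisymm (by linarith) (sq_nonneg _)
    exact pow_eq_zero_iff (two_ne_zero) |>.1 this
  have h4 : z 1 ^ 2 ≤ lam ^ 2 := by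
    rw [← div_le_one (by positivity)]
    linarith [sq_nonneg (z 0)]
  have h5 : s * z 1 = lam := le_antisymm (by
    refine le_of_sq_le_sq ?_ h0.le
    nlinarith) hcon
  apply hne
  ext i
  fin_cases i
  · simpa [xStar] using h3
  · have : z 1 = s * lam := by rw [← h5, ← mul_assoc, hs2, one_mul]
    simpa [xStar] using this

lemma pathRegret_envPlay_congr {Ω Ω' : Type*} (lam s L G : ℝ) (T : ℕ) {X : ℕ → Ω → Bool}
    {X' : ℕ → Ω' → Bool} {ω : Ω} {ω' : Ω'} (h : ∀ k < T, X k ω = X' k ω') (z : Vec 2) :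
    pathRegret T (envLoss s L X ω) (envPlay lam s L G T X ω) z
      = pathRegret T (envLoss s L X' ω') (envPlay lam s L G T X' ω') z := by
  rw [pathRegret_envLoss, pathRegret_envLoss]
  refine Finset.sum_congr rfl fun t ht => ?_
  have htT := Finset.mem_range.1 ht
  rw [h t htT, envPlay_congr lam s L G T fun k hk => h k (hk.trans htT)]

end OCO

/-! ### Averaging over P and collecting constants -/

theorem mainTheorem8 (G₀ : ℝ) :
    ∃ C : ℝ, 0 < C ∧
      ∀ (lam L s G : ℝ) (T : ℕ), lam ∈ Set.Ioo (0 : ℝ) 1 → L ∈ Set.Ioo (0 : ℝ) 1 →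
        (s = 1 ∨ s = -1) → Real.sqrt (1 + L ^ 2) ≤ G → G ≤ G₀ → 2 ≤ T →
      ∀ (Ω : Type*) [MeasurableSpace Ω] (μ : Measure Ω) [IsProbabilityMeasure μ]
        (P : Ω → ℝ) (X : ℕ → Ω → Bool),
        OCO.IsBernoulliMixture μ P X T →
        ((∃ k : ℝ, 0 < k ∧ μ.map P = betaMeasure k k) ∨ μ.map P = Measure.dirac (1 / 2)) →
        -- `xStar s lam` is the unique minimizer over `W_λ` of the expected cumulative loss
        (OCO.xStar s lam ∈ OCO.ellipse lam ∧
          ∀ z ∈ OCO.ellipse lam, z ≠ OCO.xStar s lam →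
            ∫ ω, ∑ t ∈ Finset.range T, OCO.envLoss s L X ω t (OCO.xStar s lam) ∂μ <
              ∫ ω, ∑ t ∈ Finset.range T, OCO.envLoss s L X ω t z ∂μ) ∧
        -- the decisions are feasible
        (∀ ω, ∀ t < T, OCO.envPlay lam s L G T X ω t ∈ OCO.ellipse lam) ∧
        -- the regret bound
        Integrable (fun ω => OCO.pathRegret T (OCO.envLoss s L X ω)
          (OCO.envPlay lam s L G T X ω) (OCO.xStar s lam)) μ ∧
        ∫ ω, OCO.pathRegret T (OCO.envLoss s L X ω)
            (OCO.envPlay lam s L G T X ω) (OCO.xStar s lam) ∂μ ≤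
          C * (1 / (lam * L) * Real.log T
            + G * Metric.diam (OCO.ellipse lam) * Real.log T) := by
  -- From log T ≥ 1/2 follows 16(8 log T + 1) ≤ 160 log T; adding 1 to G₀² keeps the constant
  -- positive for every real G₀.
  refine ⟨160 * (G₀ ^ 2 + 1), by positivity, ?_⟩
  rintro lam L s G T ⟨h0, h1⟩ ⟨hL0, hL1⟩ hs hG hGG₀ hT Ω _ μ _ P X hX hP
  have hG0 : 0 < G := lt_of_lt_of_le (Real.sqrt_pos.2 (by positivity)) hG
  have hD := OCO.diam_ellipse h0 h1
  have hT0 : (0 : ℝ) < T := by exact_mod_cast (by omega : 0 < T)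
  have hν : ∀ᵐ p ∂μ.map P, p ∈ Set.Icc (0 : ℝ) 1 := by
    rcases hP with ⟨k, _, hk⟩ | hP
    · rw [hk]; exact OCO.ae_betaMeasure_mem_Icc k k
    · rw [hP]
      exact (ae_dirac_iff (p := (· ∈ Set.Icc (0 : ℝ) 1)) measurableSet_Icc).2 (by norm_num)
  have hmean : ∫ p, (2 * p - 1) ∂μ.map P = 0 := by
    rcases hP with ⟨k, _, hk⟩ | hP
    · rw [hk]; exact OCO.integral_betaMeasure_self k
    · rw [hP, integral_dirac]; norm_num
  have : IsProbabilityMeasure (μ.map P) :=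
    Measure.isProbabilityMeasure_map hX.measurable_P.aemeasurable
  let F : (Fin T → Bool) → ℝ := fun x => OCO.pathRegret T (OCO.envLoss s L (OCO.trial T) x)
    (OCO.envPlay lam s L G T (OCO.trial T) x) (OCO.xStar s lam)
  have hF : ∀ ω, OCO.pathRegret T (OCO.envLoss s L X ω) (OCO.envPlay lam s L G T X ω)
      (OCO.xStar s lam) = F fun i => X i ω := fun ω =>
    OCO.pathRegret_envPlay_congr lam s L G T (fun k hk => by simp [OCO.trial, hk]) _
  have hxs := OCO.xStar_mem_ellipse h0 hs
  refine ⟨⟨hxs, fun z hz hne => ?_⟩, fun ω t _ => ?_, ?_, ?_⟩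
  · rw [hX.integral_sum_envLoss hν hmean, hX.integral_sum_envLoss hν hmean]
    have hlt := OCO.mul_lt_of_ne_xStar h0 hs hz hne
    have hs2 : s * s = 1 := by rcases hs with rfl | rfl <;> norm_num
    have e : (OCO.xStar s lam) 1 = s * lam := by simp [OCO.xStar]
    rw [e]
    apply mul_lt_mul_of_pos_left _ hT0
    have h2 : s * L * (s * lam) = L * lam := by
      calc _ = s * s * (L * lam) := by ring
        _ = _ := by rw [hs2, one_mul]
    have h3 := mul_lt_mul_of_pos_left hlt hL0
    linarith
  · exact OCO.maler_mem (OCO.isCompact_ellipse h0 h1) (OCO.convex_ellipse lam)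
      (OCO.zero_mem_ellipse lam) hG0 (by rw [hD]; norm_num) (by omega) _ t
  · simp only [hF]
    exact hX.integrable_comp F
  · simp only [hF]
    obtain ⟨hint, heq⟩ := hX.integral_comp hν F
    rw [heq]
    have hb : ∫ p, ∑ x, OCO.trialWeight p x * F x ∂μ.map P
        ≤ 16 * (8 * Real.log T + 1) * G ^ 2 / (lam * L) + 10 * (G * 2) * (8 * Real.log T) := by
      refine (integral_mono_ae hint (integrable_const (16 * (8 * Real.log T + 1) * G ^ 2
        / (lam * L) + 10 * (G * 2) * (8 * Real.log T))) ?_).trans_eq (by simp)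
      filter_upwards [hν] with p hp
      exact OCO.expected_pathRegret_le h0 h1 hL0 hs hG hT hp hxs
    refine hb.trans ?_
    rw [hD]
    have hlog : 1 / 2 ≤ Real.log T := by
      have := Real.log_le_log (by norm_num) (by exact_mod_cast hT : (2 : ℝ) ≤ T)
      linarith [Real.log_two_gt_d9]
    have hGsq : G ^ 2 ≤ G₀ ^ 2 := pow_le_pow_left₀ hG0.le hGG₀ 2
    have hA : 16 * (8 * Real.log T + 1) * G ^ 2 / (lam * L)
        ≤ 160 * (G₀ ^ 2 + 1) * (1 / (lam * L) * Real.log T) := by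
      rw [one_div_mul_eq_div, ← mul_div_assoc]
      gcongr ?_ / _
      calc 16 * (8 * Real.log T + 1) * G ^ 2 ≤ 160 * Real.log T * (G₀ ^ 2 + 1) :=
            mul_le_mul (by linarith) (by linarith) (sq_nonneg G) (by linarith)
        _ = _ := by ring
    have hB : 10 * (G * 2) * (8 * Real.log T)
        ≤ 160 * (G₀ ^ 2 + 1) * (G * 2 * Real.log T) := by
      have : 0 ≤ G * 2 * Real.log T := by positivity
      nlinarith [mul_nonneg (sq_nonneg G₀) this]
    linarith
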